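/- Let $\Omega\subset\mathbb C$ be a simply connected domain. Identify $\mathbb R^2$ with $\mathbb C$, with the Euclidean inner product $\langle\xi,\eta\rangle=\operatorname{Re}(\xi\bar\eta)$, and write $\nabla u=u_x+iu_y$, $f_z=\frac12(f_x-if_y)$, $f_{\bar z}=\frac12(f_x+if_y)$ for weak derivatives. For $K\ge 1$, say that $A:\Omega\times\mathbb C\to\mathbb C$ is strongly elliptic with constant $K+\frac1K$ if $z\mapsto A(z,\xi)$ is measurable for every $\xi$, and for all $z\in\Omega$ and $\xi_1,\xi_2\in\mathbb C$ $$|\xi_1-\xi_2|^2+|A(z,\xi_1)-A(z,\xi_2)|^2\le\Big(K+\frac1K\Big)\langle \xi_1-\xi_2,\,A(z,\xi_1)-A(z,\xi_2)\rangle,\qquad A(z,0)=0 .$$ For $0\le k<1$, say that $\mathcal H:\Omega\times\mathbb C\to\mathbb C$ is a $k$-Lipschitz field if $z\mapsto\mathcal H(z,\zeta)$ is measurable for every $\zeta$ and $|\mathcal H(z,\zeta)-\mathcal H(z,\eta)|\le k|\zeta-\eta|$ for all $z\in\Omega$, $\zeta,\eta\in\mathbb C$. (i) Let $0\le k<1$,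 let $\mathcal H$ be a $k$-Lipschitz field and let $G:\Omega\to\mathbb C$. Then there are $A$, strongly elliptic with constant $K+\frac1K$ for $K=\frac{1+k}{1-k}$, and $g\in L^2_{\rm loc}(\Omega,\mathbb C)$, such that for every $f\in W^{1,2}_{\rm loc}(\Omega,\mathbb C)$ satisfying $$f_{\bar z}=\mathcal H(z,f_z)+G\quad\text{a.e. in }\Omega,$$ the function $u=\operatorname{Re}f\in W^{1,2}_{\rm loc}(\Omega,\mathbb R)$ is a distributional solution of $\operatorname{div}A(z,\nabla u)=\operatorname{div}g$ in $\Omega$. (ii) Conversely, let $K\ge1$, let $A$ be strongly elliptic with constant $K+\frac1K$ and let $g\in L^2_{\rm loc}(\Omega,\mathbb C)$. Then there are a $k$-Lipschitz field $\mathcal H$ with $k=\frac{K-1}{K+1}$ and $\mathcal H(z,0)=0$ for all $z\in\Omega$, and $G\in L^2_{\rm loc}(\Omega,\mathbb C)$, such that for every distributional solution $u\in W^{1,2}_{\rm loc}(\Omega,\mathbb R)$ of $\operatorname{div}A(z,\nabla u)=\operatorname{div}g$ in $\Omega$ there is $v\in W^{1,2}_{\rm loc}(\Omega,\mathbb R)$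 such that $f=u+iv$ satisfies $f_{\bar z}=\mathcal H(z,f_z)+G$ a.e. in $\Omega$. (iii) The constants in (i) and (ii) correspond exactly: for $0\le k<1$ and $K\ge1$, $K=\frac{1+k}{1-k}$ if and only if $k=\frac{K-1}{K+1}$. -/

import Mathlib

open MeasureTheory Complex

/-- Test functions on `Ω`: real-valued, smooth, with compact support contained in `Ω`. -/
structure IsTestFun (Ω : Set ℂ) (φ : ℂ → ℝ) : Prop where
  smooth : ContDiff ℝ ((⊤ : ℕ∞) : WithTop ℕ∞) φ
  compactSupport : HasCompactSupport φ
  support_subset : tsupport φ ⊆ Ω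

/-- `f ∈ L²_loc(Ω)`: `f` is square integrable on every compact subset of `Ω`. -/
def MemL2loc {F : Type*} [NormedAddCommGroup F] (Ω : Set ℂ) (f : ℂ → F) : Prop :=
  ∀ C : Set ℂ, IsCompact C → C ⊆ Ω → MemLp f 2 (volume.restrict C)

/-- `f` belongs to `W^{1,2}_loc(Ω)`, with weak partial derivatives `fx`, `fy` with respect to the
real coordinates `x = re z`, `y = im z`. -/
structure HasWeakGrad {F : Type*} [NormedAddCommGroup F] [NormedSpace ℝ F]
    (Ω : Set ℂ) (f fx fy : ℂ → F) : Prop where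
  memL2loc : MemL2loc Ω f
  memL2loc_x : MemL2loc Ω fx
  memL2loc_y : MemL2loc Ω fy
  weak_x : ∀ φ : ℂ → ℝ, IsTestFun Ω φ →
    ∫ z in Ω, fderiv ℝ φ z 1 • f z = - ∫ z in Ω, φ z • fx z
  weak_y : ∀ φ : ℂ → ℝ, IsTestFun Ω φ →
    ∫ z in Ω, fderiv ℝ φ z I • f z = - ∫ z in Ω, φ z • fy z

/-- The local Sobolev space `W^{1,2}_loc(Ω, F)`. -/
def MemW12loc {F : Type*} [NormedAddCommGroup F] [NormedSpace ℝ F]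
    (Ω : Set ℂ) (f : ℂ → F) : Prop :=
  ∃ fx fy : ℂ → F, HasWeakGrad Ω f fx fy

/-- `H(z,ζ)` is Lebesgue measurable in `z ∈ Ω` and `k`-Lipschitz in `ζ`. -/
structure IsLipschitzField (Ω : Set ℂ) (k : ℝ) (H : ℂ → ℂ → ℂ) : Prop where
  measurable : ∀ ζ : ℂ, AEMeasurable (fun z => H z ζ) (volume.restrict Ω)
  lipschitz : ∀ z ∈ Ω, ∀ ζ η : ℂ, ‖H z ζ - H z η‖ ≤ k * ‖ζ - η‖

/-- The strong ellipticity condition with constant `K + 1/K`; `ℝ²` is identified with `ℂ`, whose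
real inner product is the Euclidean one. -/
structure IsStronglyElliptic (Ω : Set ℂ) (K : ℝ) (A : ℂ → ℂ → ℂ) : Prop where
  measurable : ∀ ξ : ℂ, AEMeasurable (fun z => A z ξ) (volume.restrict Ω)
  elliptic : ∀ z ∈ Ω, ∀ ξ₁ ξ₂ : ℂ,
    ‖ξ₁ - ξ₂‖ ^ 2 + ‖A z ξ₁ - A z ξ₂‖ ^ 2 ≤
      (K + 1 / K) * inner ℝ (ξ₁ - ξ₂) (A z ξ₁ - A z ξ₂)
  map_zero : ∀ z ∈ Ω, A z 0 = 0

/-- `f ∈ W^{1,2}_loc(Ω, ℂ)` solves `f_{z̄} = H(z, f_z) + G` almost everywhere in `Ω`, where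
`f_z = (f_x - i f_y) / 2` and `f_{z̄} = (f_x + i f_y) / 2`. -/
def SolvesBeltrami (Ω : Set ℂ) (H : ℂ → ℂ → ℂ) (G : ℂ → ℂ) (f : ℂ → ℂ) : Prop :=
  ∃ fx fy : ℂ → ℂ, HasWeakGrad Ω f fx fy ∧
    ∀ᵐ z ∂(volume.restrict Ω),
      (fx z + I * fy z) / 2 = H z ((fx z - I * fy z) / 2) + G z

/-- `div V = div W` in `Ω` in the sense of distributions, for locally integrable planar vector
fields `V`, `W`; note `fderiv ℝ φ z w = ⟨∇φ(z), w⟩`. -/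
structure DivEq (Ω : Set ℂ) (V W : ℂ → ℂ) : Prop where
  locInt_left : LocallyIntegrableOn V Ω
  locInt_right : LocallyIntegrableOn W Ω
  weak : ∀ φ : ℂ → ℝ, IsTestFun Ω φ →
    ∫ z in Ω, fderiv ℝ φ z (V z) = ∫ z in Ω, fderiv ℝ φ z (W z)

/-- `u ∈ W^{1,2}_loc(Ω, ℝ)` is a distributional solution of `div A(z, ∇u) = div g` in `Ω`, where
`∇u = u_x + i u_y`. -/
def SolvesLerayLions (Ω : Set ℂ) (A : ℂ → ℂ → ℂ) (g : ℂ → ℂ) (u : ℂ → ℝ) : Prop :=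
  ∃ ux uy : ℂ → ℝ, HasWeakGrad Ω u ux uy ∧
    DivEq Ω (fun z => A z ((ux z : ℂ) + I * (uy z : ℂ))) g

/-! For `f = u + iv` the Wirtinger derivatives satisfy `conj f_z + f_z̄ = ∇u` and `conj f_z - f_z̄ =
v_y - i v_x`, and the second field is divergence free. The Beltrami and the divergence-form equation
are therefore the same relation in two coordinate systems, `p = f_z ↔ ξ = conj p + H(p)` and `A(ξ) =
conj p - H(p)`: a Cayley transform. By polarisation, `|y| ≤ k|x|` is the same as the ellipticity
inequality for the pair `x + y`, `x - y`, with constant `2(1 + k²)/(1 - k²) = K + 1/K`. Both changes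
of variable are inverted by Banach's fixed point theorem, which also gives measurability in `z`, the
fixed point being a limit of measurable iterates (`IsLipschitzField.exists_isStronglyElliptic`,
`IsStronglyElliptic.exists_isLipschitzField`). Inhomogeneous terms are absorbed by translating the
fields in their second argument.

From Beltrami to divergence form, what remains is that the rotated gradient of `v` is weakly
divergence free, by symmetry of second derivatives of test functions. The converse needs a stream
function `v`, that is, a Poincaré lemma for `L²_loc` fields
(`exists_hasWeakGrad_of_isSimplyConnected`); only here does simple connectedness enter.

That lemma is proved by duality, without mollification. On a rectangle, `rayInt` inverts a
directional derivative up to sign and preserves compact support; its adjoint applied to `P`, plus a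
function of `y` alone, is a primitive. The same operator writes a test function as a sum of
derivatives and a multiple of a fixed bump, so primitives differ by constants on overlaps of
squares. These constants form a cocycle; it defines a covering space with discrete fibre, and a
global section of it (`exists_coboundary`) lets the local primitives be glued. -/

open scoped Manifold ComplexConjugate

/-! ### Integrals of functions along parallel lines -/

/-- The integral of `φ` along the line `z + ℝ e` against a measure on the parameter. -/
noncomputable def lineInt {F : Type*} [NormedAddCommGroup F] [NormedSpace ℝ F]
    (μ : Measure ℝ) (e : ℂ) (φ : ℂ → F) (z : ℂ) : F := ∫ t, φ (z + t • e) ∂μ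

section LineInt

variable {F : Type} [NormedAddCommGroup F]

theorem hasCompactSupport_comp_line {ℓ : ℂ →L[ℝ] ℝ} {e : ℂ} (he : ℓ e = 1) {L : ℝ} {φ : ℂ → F}
    (hL : ∀ z, L < |ℓ z| → φ z = 0) (z : ℂ) : HasCompactSupport fun t : ℝ => φ (z + t • e) := by
  refine HasCompactSupport.intro (isCompact_Icc (a := -(L + |ℓ z|)) (b := L + |ℓ z|)) ?_
  intro t ht
  apply hL
  simp only [map_add, map_smul, he, smul_eq_mul, mul_one]
  by_contra! h
  apply ht
  have h1 := abs_le.1 h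
  have h2 := neg_abs_le (ℓ z)
  have h3 := le_abs_self (ℓ z)
  constructor <;> linarith

theorem continuous_comp_line {φ : ℂ → F} (hφ : Continuous φ) (z e : ℂ) :
    Continuous fun t : ℝ => φ (z + t • e) := by fun_prop

theorem integrable_comp_line {μ : Measure ℝ} [IsLocallyFiniteMeasure μ] {ℓ : ℂ →L[ℝ] ℝ} {e : ℂ}
    (he : ℓ e = 1) {L : ℝ} {φ : ℂ → F} (hφ : Continuous φ) (hL : ∀ z, L < |ℓ z| → φ z = 0)
    (z : ℂ) : Integrable (fun t : ℝ => φ (z + t • e)) μ :=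
  (continuous_comp_line hφ z e).integrable_of_hasCompactSupport
    (hasCompactSupport_comp_line he hL z)

variable [NormedSpace ℝ F]

theorem fderiv_eq_zero_of_lt_abs {ℓ : ℂ →L[ℝ] ℝ} {L : ℝ} {φ : ℂ → F}
    (hL : ∀ z, L < |ℓ z| → φ z = 0) (z : ℂ) (hz : L < |ℓ z|) : fderiv ℝ φ z = 0 := by
  have : φ =ᶠ[nhds z] fun _ => 0 := by
    have ho : IsOpen {w : ℂ | L < |ℓ w|} := isOpen_lt continuous_const (by fun_prop)
    filter_upwards [ho.mem_nhds hz] with w hw using hL w hw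
  rw [this.fderiv_eq]
  simp

/-- Differentiation under the integral sign: for base points near `z`, only a bounded range of
parameters contributes, and there the derivative is bounded by compactness. -/
theorem hasFDerivAt_lineInt {μ : Measure ℝ} [IsLocallyFiniteMeasure μ] {ℓ : ℂ →L[ℝ] ℝ} {e : ℂ}
    (he : ℓ e = 1) {L : ℝ} {φ : ℂ → F} (hφ : ContDiff ℝ 1 φ) (hL : ∀ z, L < |ℓ z| → φ z = 0)
    (z : ℂ) : HasFDerivAt (lineInt μ e φ) (lineInt μ e (fderiv ℝ φ) z) z := by
  have hc' : Continuous (fderiv ℝ φ) := hφ.continuous_fderiv one_ne_zero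
  -- If `‖w - z‖ < 1` then `|ℓ w| ≤ |ℓ z| + ‖ℓ‖`, so `φ` and its derivative vanish at `w + t e` once
  -- `|t| > M`.
  set M : ℝ := L + |ℓ z| + ‖ℓ‖ with hM
  obtain ⟨C, hC⟩ := (isCompact_closedBall z (1 + |M| * ‖e‖)).exists_bound_of_continuousOn
    hc'.continuousOn
  have hC0 : 0 ≤ C := (norm_nonneg _).trans (hC z (Metric.mem_closedBall_self (by positivity)))
  refine hasFDerivAt_integral_of_dominated_of_fderiv_le (𝕜 := ℝ)
    (F' := fun w t => fderiv ℝ φ (w + (t : ℝ) • e))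
    (bound := (Set.Icc (-M) M).indicator fun _ => C)
    (Metric.ball_mem_nhds z one_pos) ?_ ?_ ?_ ?_ ?_ ?_
  · exact Filter.Eventually.of_forall fun w =>
      (continuous_comp_line hφ.continuous w e).aestronglyMeasurable
  · exact integrable_comp_line he hφ.continuous hL z
  · exact (continuous_comp_line hc' z e).aestronglyMeasurable
  · refine Filter.Eventually.of_forall fun t w hw => ?_
    rw [Metric.mem_ball, dist_eq_norm] at hw
    by_cases ht : t ∈ Set.Icc (-M) M
    · rw [Set.indicator_of_mem ht]
      apply hC
      rw [Metric.mem_closedBall, dist_eq_norm]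
      calc ‖w + t • e - z‖ = ‖(w - z) + t • e‖ := by congr 1; ring
        _ ≤ ‖w - z‖ + ‖t • e‖ := norm_add_le _ _
        _ ≤ 1 + |M| * ‖e‖ := by
          rw [norm_smul, Real.norm_eq_abs]
          have : |t| ≤ |M| := (abs_le.2 ht).trans (le_abs_self M)
          gcongr
    · rw [Set.indicator_of_notMem ht, fderiv_eq_zero_of_lt_abs hL, norm_zero]
      by_contra! h
      apply ht
      simp only [map_add, map_smul, he, smul_eq_mul, mul_one] at h
      have h4 : |ℓ w - ℓ z| ≤ ‖ℓ‖ := by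
        rw [← map_sub]
        calc |ℓ (w - z)| ≤ ‖ℓ‖ * ‖w - z‖ := ℓ.le_opNorm _
          _ ≤ ‖ℓ‖ * 1 := by gcongr
          _ = ‖ℓ‖ := mul_one _
      have h1 := abs_le.1 h
      have h2 := neg_abs_le (ℓ z)
      have h3 := le_abs_self (ℓ z)
      have h5 := abs_le.1 h4
      constructor <;> linarith
  · exact (integrable_indicator_iff measurableSet_Icc).2
      (integrableOn_const isCompact_Icc.measure_lt_top.ne)
  · refine Filter.Eventually.of_forall fun t w _ => ?_
    have h1 := (hφ.differentiable one_ne_zero (w + t • e)).hasFDerivAt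
    simpa [Function.comp_def] using h1.comp w ((hasFDerivAt_id w).add_const (t • e))

/-- The target space is quantified inside the induction because the induction hypothesis is applied
to `fderiv ℝ φ`, which takes values in another space. -/
theorem contDiff_lineInt_nat {μ : Measure ℝ} [IsLocallyFiniteMeasure μ] {ℓ : ℂ →L[ℝ] ℝ} {e : ℂ}
    (he : ℓ e = 1) {L : ℝ} (n : ℕ) : ∀ {F : Type} [NormedAddCommGroup F] [NormedSpace ℝ F]
    {φ : ℂ → F}, ContDiff ℝ (n + 1 : ℕ) φ → (∀ z, L < |ℓ z| → φ z = 0) →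
    ContDiff ℝ n (lineInt μ e φ) := by
  induction n with
  | zero =>
    intro F _ _ φ hφ hL
    have := fun z => (hasFDerivAt_lineInt (μ := μ) he (by simpa using hφ) hL z).continuousAt
    simpa using continuous_iff_continuousAt.2 this
  | succ n ih =>
    intro F _ _ φ hφ hL
    have h1 : ContDiff ℝ 1 φ := hφ.of_le (by norm_cast; omega)
    have hd := hasFDerivAt_lineInt (μ := μ) he h1 hL
    have hf : fderiv ℝ (lineInt μ e φ) = lineInt μ e (fderiv ℝ φ) :=
      funext fun z => (hd z).fderiv
    have : ((n + 1 : ℕ) : WithTop ℕ∞) = (n : WithTop ℕ∞) + 1 := by norm_cast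
    rw [this, contDiff_succ_iff_fderiv, hf]
    refine ⟨fun z => (hd z).differentiableAt, by simp, ih ?_ (fderiv_eq_zero_of_lt_abs hL)⟩
    exact hφ.fderiv_right (by norm_cast)

theorem contDiff_lineInt {μ : Measure ℝ} [IsLocallyFiniteMeasure μ] {ℓ : ℂ →L[ℝ] ℝ} {e : ℂ}
    (he : ℓ e = 1) {L : ℝ} {φ : ℂ → F} (hφ : ContDiff ℝ ((⊤ : ℕ∞) : WithTop ℕ∞) φ)
    (hL : ∀ z, L < |ℓ z| → φ z = 0) : ContDiff ℝ ((⊤ : ℕ∞) : WithTop ℕ∞) (lineInt μ e φ) :=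
  contDiff_infty.2 fun n => contDiff_lineInt_nat he n (hφ.of_le (by exact_mod_cast le_top)) hL

theorem fderiv_lineInt_apply {μ : Measure ℝ} [IsLocallyFiniteMeasure μ] {ℓ : ℂ →L[ℝ] ℝ} {e : ℂ}
    (he : ℓ e = 1) {L : ℝ} {φ : ℂ → F} (hφ : ContDiff ℝ 1 φ) (hL : ∀ z, L < |ℓ z| → φ z = 0)
    (z v : ℂ) : fderiv ℝ (lineInt μ e φ) z v = lineInt μ e (fun w => fderiv ℝ φ w v) z := by
  rw [(hasFDerivAt_lineInt he hφ hL z).fderiv, lineInt, lineInt,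
    ContinuousLinearMap.integral_apply]
  exact integrable_comp_line he (hφ.continuous_fderiv one_ne_zero)
    (fderiv_eq_zero_of_lt_abs hL) z

theorem deriv_comp_line {φ : ℂ → F} (hφ : ContDiff ℝ 1 φ) (z e : ℂ) :
    deriv (fun t : ℝ => φ (z + t • e)) = fun t => fderiv ℝ φ (z + t • e) e := by
  funext t
  have h1 : HasDerivAt (fun t : ℝ => z + t • e) e t := by
    simpa using ((hasDerivAt_id t).smul_const e).const_add z
  exact ((hφ.differentiable one_ne_zero (z + t • e)).hasFDerivAt.comp_hasDerivAt t h1).deriv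

theorem lineInt_Ioi_fderiv [CompleteSpace F] {ℓ : ℂ →L[ℝ] ℝ} {e : ℂ} (he : ℓ e = 1) {L : ℝ}
    {φ : ℂ → F} (hφ : ContDiff ℝ 1 φ) (hL : ∀ z, L < |ℓ z| → φ z = 0) (z : ℂ) :
    lineInt (volume.restrict (Set.Ioi 0)) e (fun w => fderiv ℝ φ w e) z = -φ z := by
  have := HasCompactSupport.integral_Ioi_deriv_eq (f := fun t : ℝ => φ (z + t • e))
    (by fun_prop) (hasCompactSupport_comp_line he hL z) 0
  rw [deriv_comp_line hφ] at this
  simpa [lineInt] using this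

theorem lineInt_fderiv {ℓ : ℂ →L[ℝ] ℝ} {e : ℂ} (he : ℓ e = 1) {L : ℝ}
    {φ : ℂ → F} (hφ : ContDiff ℝ 1 φ) (hL : ∀ z, L < |ℓ z| → φ z = 0) (z : ℂ) :
    lineInt volume e (fun w => fderiv ℝ φ w e) z = 0 := by
  rw [lineInt, ← deriv_comp_line hφ]
  refine integral_eq_zero_of_hasDerivAt_of_integrable (f := fun t : ℝ => φ (z + t • e))
    (fun t => ?_) ?_ (integrable_comp_line he hφ.continuous hL z)
  · have : ContDiff ℝ 1 (fun t : ℝ => φ (z + t • e)) := by fun_prop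
    exact (this.differentiable one_ne_zero t).hasDerivAt
  · rw [deriv_comp_line hφ]
    refine integrable_comp_line he (φ := fun w => fderiv ℝ φ w e)
      ((hφ.continuous_fderiv one_ne_zero).clm_apply continuous_const) (L := L) (fun w hw => ?_) z
    rw [fderiv_eq_zero_of_lt_abs hL w hw, zero_apply]

end LineInt

/-! ### Compactly supported antiderivatives along a direction -/

/-- The tail integral `∫_s^∞ ω`. -/
noncomputable def tailInt (ω : ℝ → ℝ) (s : ℝ) : ℝ := ∫ t in Set.Ioi 0, ω (s + t)

/-- The integral of `φ` over the ray `z + [0, ∞) e`, corrected by a multiple of the integral over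
the whole line such that compactly supported functions go to compactly supported ones. -/
noncomputable def rayInt (ℓ : ℂ →L[ℝ] ℝ) (e : ℂ) (ω : ℝ → ℝ) (φ : ℂ → ℝ) (z : ℂ) : ℝ :=
  lineInt (volume.restrict (Set.Ioi 0)) e φ z - tailInt ω (ℓ z) * lineInt volume e φ z

section RayInt

variable {ℓ : ℂ →L[ℝ] ℝ} {e : ℂ} {ω : ℝ → ℝ} {φ : ℂ → ℝ} {L : ℝ}

/-- As a ray integral, the tail inherits smoothness and a derivative formula from `lineInt`. -/
theorem tailInt_comp (he : ℓ e = 1) (ω : ℝ → ℝ) : (fun z => tailInt ω (ℓ z)) =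
    lineInt (volume.restrict (Set.Ioi 0)) e (fun w => ω (ℓ w)) := by
  funext z
  simp [tailInt, lineInt, he, -Complex.real_smul]

theorem contDiff_tailInt (he : ℓ e = 1) (hω : ContDiff ℝ ((⊤ : ℕ∞) : WithTop ℕ∞) ω)
    (hωL : ∀ t, L < |t| → ω t = 0) :
    ContDiff ℝ ((⊤ : ℕ∞) : WithTop ℕ∞) (fun z => tailInt ω (ℓ z)) := by
  rw [tailInt_comp he]
  exact contDiff_lineInt he (hω.comp ℓ.contDiff) (L := L) fun z hz => hωL _ hz

theorem fderiv_tailInt (he : ℓ e = 1) (hω : ContDiff ℝ 1 ω) (hωL : ∀ t, L < |t| → ω t = 0)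
    (z v : ℂ) : fderiv ℝ (fun z => tailInt ω (ℓ z)) z v = -(ω (ℓ z) * ℓ v) := by
  have h1 : ContDiff ℝ 1 (fun w => ω (ℓ w)) := hω.comp ℓ.contDiff
  have h2 : ∀ z, L < |ℓ z| → ω (ℓ z) = 0 := fun z hz => hωL _ hz
  rw [tailInt_comp he, fderiv_lineInt_apply he h1 h2]
  have h3 : ∀ w v, fderiv ℝ (fun w => ω (ℓ w)) w v = ℓ v * deriv ω (ℓ w) := by
    intro w v
    have := (hω.differentiable one_ne_zero (ℓ w)).hasDerivAt.comp_hasFDerivAt w ℓ.hasFDerivAt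
    have h4 := this.fderiv
    rw [Function.comp_def] at h4
    rw [h4]
    simp [mul_comm]
  have h4 := lineInt_Ioi_fderiv he h1 h2 z
  simp only [h3, he, one_mul] at h4
  simp only [h3]
  simp only [lineInt] at h4 ⊢
  rw [integral_const_mul, h4]
  ring

theorem contDiff_rayInt (he : ℓ e = 1) (hφ : ContDiff ℝ ((⊤ : ℕ∞) : WithTop ℕ∞) φ)
    (hL : ∀ z, L < |ℓ z| → φ z = 0) (hω : ContDiff ℝ ((⊤ : ℕ∞) : WithTop ℕ∞) ω)
    (hωL : ∀ t, L < |t| → ω t = 0) :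
    ContDiff ℝ ((⊤ : ℕ∞) : WithTop ℕ∞) (rayInt ℓ e ω φ) :=
  (contDiff_lineInt he hφ hL).sub ((contDiff_tailInt he hω hωL).mul (contDiff_lineInt he hφ hL))

/-- The line integrals commute with differentiation, so the correction comes only from
differentiating the tail factor. It disappears in directions with `ℓ v = 0`. -/
theorem fderiv_rayInt_apply (he : ℓ e = 1) (hφ : ContDiff ℝ 1 φ)
    (hL : ∀ z, L < |ℓ z| → φ z = 0) (hω : ContDiff ℝ ((⊤ : ℕ∞) : WithTop ℕ∞) ω)
    (hωL : ∀ t, L < |t| → ω t = 0) (z v : ℂ) :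
    fderiv ℝ (rayInt ℓ e ω φ) z v = rayInt ℓ e ω (fun w => fderiv ℝ φ w v) z +
      ω (ℓ z) * ℓ v * lineInt volume e φ z := by
  have h1 := (hasFDerivAt_lineInt (μ := volume.restrict (Set.Ioi 0)) he hφ hL z)
  have h2 := (hasFDerivAt_lineInt (μ := volume) he hφ hL z)
  have h3 := ((contDiff_tailInt he hω hωL).differentiable (by simp) z).hasFDerivAt
  have h4 := (h1.sub (h3.mul h2)).fderiv
  have h5 : fderiv ℝ (rayInt ℓ e ω φ) z = _ := h4
  rw [h5]
  simp only [sub_apply, add_apply, smul_apply, smul_eq_mul]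
  rw [fderiv_tailInt he (hω.of_le (by simp)) hωL, ← h1.fderiv, ← h2.fderiv,
    fderiv_lineInt_apply he hφ hL, fderiv_lineInt_apply he hφ hL, rayInt]
  ring

theorem rayInt_fderiv (he : ℓ e = 1) (hφ : ContDiff ℝ 1 φ)
    (hL : ∀ z, L < |ℓ z| → φ z = 0) (z : ℂ) :
    rayInt ℓ e ω (fun w => fderiv ℝ φ w e) z = -φ z := by
  rw [rayInt, lineInt_Ioi_fderiv he hφ hL, lineInt_fderiv he hφ hL]
  ring

/-- Beyond `b` both the ray integral and the tail vanish. Before `a` the ray already carries the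
full line integral and the tail equals `∫ ω = 1`, so the two terms cancel. If `m z ∉ S`, the whole
line misses the support. -/
theorem rayInt_eq_zero {m : ℂ →L[ℝ] ℝ} (he : ℓ e = 1) (hm : m e = 0) {a b : ℝ} {S : Set ℝ}
    (hz : ∀ z, ¬(ℓ z ∈ Set.Icc a b ∧ m z ∈ S) → φ z = 0)
    (hω0 : ∀ t, t ∉ Set.Icc a b → ω t = 0) (hω1 : ∫ t, ω t = 1) (z : ℂ)
    (h : ¬(ℓ z ∈ Set.Icc a b ∧ m z ∈ S)) : rayInt ℓ e ω φ z = 0 := by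
  by_cases hS : m z ∈ S
  · have hz1 : ∀ t : ℝ, ℓ z + t ∉ Set.Icc a b → φ (z + t • e) = 0 := by
      intro t ht
      apply hz
      simp only [map_add, map_smul, he, smul_eq_mul, mul_one]
      exact fun h => ht h.1
    by_cases hb : b < ℓ z
    · have h1 : lineInt (volume.restrict (Set.Ioi 0)) e φ z = 0 := by
        refine setIntegral_eq_zero_of_forall_eq_zero fun t ht => hz1 t fun h' => ?_
        have := h'.2
        have := ht.out
        linarith
      have h2 : tailInt ω (ℓ z) = 0 := by
        refine setIntegral_eq_zero_of_forall_eq_zero fun t ht => hω0 _ fun h' => ?_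
        have := h'.2
        have := ht.out
        linarith
      rw [rayInt, h1, h2]
      ring
    · have ha : ℓ z < a := by
        by_contra! ha
        exact h ⟨⟨ha, not_lt.1 hb⟩, hS⟩
      have h1 : lineInt (volume.restrict (Set.Ioi 0)) e φ z = lineInt volume e φ z := by
        refine setIntegral_eq_integral_of_forall_compl_eq_zero fun t ht => hz1 t fun h' => ?_
        have := h'.1
        have : t ≤ 0 := not_lt.1 ht
        linarith
      have h2 : tailInt ω (ℓ z) = 1 := by
        rw [← hω1, ← integral_add_left_eq_self ω (ℓ z)]
        refine setIntegral_eq_integral_of_forall_compl_eq_zero fun t ht => hω0 _ fun h' => ?_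
        have := h'.1
        have : t ≤ 0 := not_lt.1 ht
        linarith
      rw [rayInt, h1, h2]
      ring
  · have h0 : ∀ t : ℝ, φ (z + t • e) = 0 := by
      intro t
      apply hz
      simp only [map_add, map_smul, hm, smul_zero, add_zero]
      exact fun h => hS h.2
    simp [rayInt, lineInt, h0, -Complex.real_smul]

end RayInt

/-! ### Fubini in the plane and the adjoint kernel -/

theorem continuous_mk_left (y : ℝ) : Continuous fun x : ℝ => (⟨x, y⟩ : ℂ) := by
  simp only [mk_eq_add_mul_I]
  fun_prop

/-- This involution exchanges the abscissa of the point with the extra parameter; it is the change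
of variables by which the adjoint of a horizontal integral operator is computed. -/
theorem measurePreserving_lineSwap :
    MeasurePreserving (fun q : ℂ × ℝ => ((⟨q.2, q.1.im⟩ : ℂ), q.1.re)) := by
  have hE : MeasurePreserving (Prod.map measurableEquivRealProd (id : ℝ → ℝ)) :=
    volume_preserving_equiv_real_prod.prod (MeasurePreserving.id volume)
  have hE' : MeasurePreserving (Prod.map measurableEquivRealProd.symm (id : ℝ → ℝ)) :=
    (volume_preserving_equiv_real_prod.symm).prod (MeasurePreserving.id volume)
  have hA : MeasurePreserving (MeasurableEquiv.prodAssoc : (ℝ × ℝ) × ℝ ≃ᵐ ℝ × ℝ × ℝ) :=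
    ⟨MeasurableEquiv.prodAssoc.measurable, Measure.prodAssoc_prod⟩
  have hS : MeasurePreserving (Prod.swap : ℝ × ℝ × ℝ → (ℝ × ℝ) × ℝ) :=
    Measure.measurePreserving_swap
  have hT : MeasurePreserving (Prod.map Prod.swap id : (ℝ × ℝ) × ℝ → (ℝ × ℝ) × ℝ) :=
    Measure.measurePreserving_swap.prod (MeasurePreserving.id volume)
  exact hE'.comp (hT.comp (hS.comp (hA.comp hE)))

theorem measurableEmbedding_lineSwap :
    MeasurableEmbedding (fun q : ℂ × ℝ => ((⟨q.2, q.1.im⟩ : ℂ), q.1.re)) := by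
  let e : ℂ × ℝ ≃ᵐ ℂ × ℝ :=
    { toFun := fun q => (⟨q.2, q.1.im⟩, q.1.re)
      invFun := fun q => (⟨q.2, q.1.im⟩, q.1.re)
      left_inv := fun q => rfl
      right_inv := fun q => rfl
      measurable_toFun := measurePreserving_lineSwap.measurable
      measurable_invFun := measurePreserving_lineSwap.measurable }
  exact e.measurableEmbedding

theorem integral_complex_eq_im_re {f : ℂ → ℝ} (hf : Integrable f) :
    ∫ z, f z = ∫ y : ℝ, ∫ x : ℝ, f ⟨x, y⟩ := by
  have h := volume_preserving_equiv_real_prod.symm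
  rw [← h.integral_comp measurableEquivRealProd.symm.measurableEmbedding]
  have hi := (h.integrable_comp_emb measurableEquivRealProd.symm.measurableEmbedding).2 hf
  exact integral_prod_symm _ hi

theorem integral_complex_eq_re_im {f : ℂ → ℝ} (hf : Integrable f) :
    ∫ z, f z = ∫ x : ℝ, ∫ y : ℝ, f ⟨x, y⟩ := by
  have h := volume_preserving_equiv_real_prod.symm
  rw [← h.integral_comp measurableEquivRealProd.symm.measurableEmbedding]
  have hi := (h.integrable_comp_emb measurableEquivRealProd.symm.measurableEmbedding).2 hf
  exact integral_prod _ hi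

theorem lintegral_complex_eq_im_re {f : ℂ → ENNReal} (hf : Measurable f) :
    ∫⁻ z, f z = ∫⁻ y : ℝ, ∫⁻ x : ℝ, f ⟨x, y⟩ := by
  have h := volume_preserving_equiv_real_prod.symm
  rw [← h.lintegral_comp hf]
  exact lintegral_prod_symm' _ (hf.comp measurableEquivRealProd.symm.measurable)

/-- Fubini after the swap. The double integral converges absolutely since `k` and `η` are bounded,
`P` is integrable and `η` lives in a vertical strip. -/
theorem integral_lineKernel_mul {k : ℝ → ℝ → ℝ} (hk : Measurable (Function.uncurry k)) {B : ℝ}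
    (hB : ∀ x s, |k x s| ≤ B) {P : ℂ → ℝ} (hP : Integrable P) {η : ℂ → ℝ} (hη : Measurable η)
    {C L : ℝ} (hC : ∀ z, |η z| ≤ C) (hL : ∀ z, L < |z.re| → η z = 0) :
    ∫ z, η z * (∫ s, k z.re s * P ⟨s, z.im⟩) =
      ∫ w, P w * ∫ x, k x w.re * η ⟨x, w.im⟩ := by
  have hC0 : 0 ≤ C := (abs_nonneg _).trans (hC 0)
  have hB0 : 0 ≤ B := (abs_nonneg _).trans (hB 0 0)
  let J : ℂ × ℝ → ℝ := fun q => P q.1 * (k q.2 q.1.re * η ⟨q.2, q.1.im⟩)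
  have hmk : Measurable fun q : ℂ × ℝ => k q.2 q.1.re * η ⟨q.2, q.1.im⟩ := by
    refine (hk.comp (f := fun q : ℂ × ℝ => (q.2, q.1.re)) (by fun_prop)).mul
      (hη.comp (measurePreserving_lineSwap.measurable.fst))
  have hJ : Integrable J (volume.prod volume) := by
    have h1 : Integrable (fun x : ℝ => (Set.Icc (-L) L).indicator (fun _ => B * C) x) :=
      (integrable_indicator_iff measurableSet_Icc).2
        (integrableOn_const isCompact_Icc.measure_lt_top.ne)
    refine (hP.norm.mul_prod h1).mono'
      ((hP.aestronglyMeasurable.comp_fst).mul hmk.aestronglyMeasurable) ?_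
    refine Filter.Eventually.of_forall fun q => ?_
    simp only [J, norm_mul, Real.norm_eq_abs]
    refine mul_le_mul_of_nonneg_left ?_ (abs_nonneg _)
    by_cases hq : q.2 ∈ Set.Icc (-L) L
    · rw [Set.indicator_of_mem hq]
      exact mul_le_mul (hB _ _) (hC _) (abs_nonneg _) hB0
    · rw [Set.indicator_of_notMem hq, hL _ (lt_of_not_ge fun h => hq (abs_le.1 h))]
      simp
  have hJ' := (measurePreserving_lineSwap.integrable_comp_emb measurableEmbedding_lineSwap).2 hJ
  have e1 : ∫ q, (J ∘ fun q : ℂ × ℝ => ((⟨q.2, q.1.im⟩ : ℂ), q.1.re)) q = ∫ q, J q :=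
    measurePreserving_lineSwap.integral_comp measurableEmbedding_lineSwap J
  rw [Measure.volume_eq_prod, integral_prod _ hJ', integral_prod _ hJ] at e1
  simp only [J, Function.comp_def] at e1
  convert e1 using 2
  · funext z
    rw [← integral_const_mul]
    congr 1
    funext s
    ring
  · funext z
    rw [integral_const_mul]

theorem integral_step_mul (g : ℝ → ℝ) (s : ℝ) :
    ∫ x, (if s < x then 1 else 0) * g x = ∫ t in Set.Ioi 0, g (s + t) := by
  rw [← integral_indicator measurableSet_Ioi,
    ← integral_add_left_eq_self (fun x => (if s < x then 1 else 0) * g x) s]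
  congr 1
  funext t
  by_cases ht : 0 < t <;> simp [ht]

theorem abs_tailInt_le (ω : ℝ → ℝ) (hω : Integrable ω) (s : ℝ) :
    |tailInt ω s| ≤ ∫ t, |ω t| := by
  rw [← integral_add_left_eq_self (fun t => |ω t|) s]
  refine (norm_integral_le_integral_norm (fun t => ω (s + t))).trans ?_
  exact setIntegral_le_integral (hω.comp_add_left s).norm
    (Filter.Eventually.of_forall fun t => norm_nonneg _)

/-- The kernel of the operator dual to `rayInt`. -/
noncomputable def rayKernel (ω : ℝ → ℝ) (x s : ℝ) : ℝ := (if s < x then 1 else 0) - tailInt ω s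

theorem abs_rayKernel_le {ω : ℝ → ℝ} (hω : Integrable ω) (x s : ℝ) :
    |rayKernel ω x s| ≤ 1 + ∫ t, |ω t| := by
  refine (abs_sub _ _).trans (add_le_add ?_ (abs_tailInt_le ω hω s))
  split_ifs <;> simp

theorem measurable_rayKernel {ω : ℝ → ℝ} (hω : Measurable (tailInt ω)) :
    Measurable (Function.uncurry (rayKernel ω)) := by
  refine Measurable.sub ?_ (hω.comp measurable_snd)
  exact Measurable.ite (measurableSet_lt measurable_snd measurable_fst) measurable_const
    measurable_const

theorem integral_rayKernel_mul {ω : ℝ → ℝ} {η : ℂ → ℝ} (hη : Continuous η) {L : ℝ}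
    (hL : ∀ z, L < |z.re| → η z = 0) (w : ℂ) :
    ∫ x, rayKernel ω x w.re * η ⟨x, w.im⟩ = rayInt reCLM 1 ω η w := by
  have he : reCLM (1 : ℂ) = 1 := by simp
  have hi : Integrable (fun x : ℝ => η ⟨x, w.im⟩) := by
    have := integrable_comp_line (μ := volume) (ℓ := reCLM) he hη hL ⟨0, w.im⟩
    refine this.congr (Filter.Eventually.of_forall fun x => congrArg η ?_)
    apply Complex.ext <;> simp
  have e1 : ∀ x : ℝ, (⟨w.re + x, w.im⟩ : ℂ) = w + x • (1 : ℂ) := fun x => by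
    apply Complex.ext <;> simp
  have hi' : Integrable (fun x : ℝ => (if w.re < x then 1 else 0) * η ⟨x, w.im⟩) := by
    refine hi.mono (Measurable.aestronglyMeasurable ?_) (Filter.Eventually.of_forall fun x => ?_)
    · refine Measurable.mul (Measurable.ite (measurableSet_lt measurable_const measurable_id)
        measurable_const measurable_const) ?_
      exact (hη.comp (continuous_mk_left w.im)).measurable
    · split_ifs <;> simp
  simp only [rayKernel, sub_mul]
  rw [integral_sub hi' (hi.const_mul _), integral_step_mul, integral_const_mul, rayInt,
    ← integral_add_left_eq_self (fun x : ℝ => η ⟨x, w.im⟩) w.re]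
  simp only [e1]
  rfl

/-! ### Test functions, and their antiderivatives on rectangles -/

namespace IsTestFun

variable {Ω : Set ℂ} {φ : ℂ → ℝ}

theorem of_isCompact {K : Set ℂ} (hφ : ContDiff ℝ ((⊤ : ℕ∞) : WithTop ℕ∞) φ) (hK : IsCompact K)
    (hKΩ : K ⊆ Ω) (h0 : ∀ z, z ∉ K → φ z = 0) : IsTestFun Ω φ where
  smooth := hφ
  compactSupport := HasCompactSupport.intro hK fun {z} hz => h0 z hz
  support_subset := by
    refine (closure_minimal (fun z hz => ?_) hK.isClosed).trans hKΩ
    by_contra h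
    exact hz (h0 z h)

theorem mono {Ω' : Set ℂ} (h : IsTestFun Ω φ) (hΩ : Ω ⊆ Ω') : IsTestFun Ω' φ :=
  ⟨h.smooth, h.compactSupport, h.support_subset.trans hΩ⟩

theorem contDiff_one (h : IsTestFun Ω φ) : ContDiff ℝ 1 φ := h.smooth.of_le (by simp)

theorem continuous (h : IsTestFun Ω φ) : Continuous φ := h.smooth.continuous

theorem eq_zero (h : IsTestFun Ω φ) {z : ℂ} (hz : z ∉ Ω) : φ z = 0 :=
  image_eq_zero_of_notMem_tsupport fun h' => hz (h.support_subset h')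

theorem fderiv_apply (h : IsTestFun Ω φ) (v : ℂ) : IsTestFun Ω fun z => fderiv ℝ φ z v where
  smooth := (h.smooth.fderiv_right (m := ((⊤ : ℕ∞) : WithTop ℕ∞)) (by simp)).clm_apply
    contDiff_const
  compactSupport := h.compactSupport.fderiv_apply (𝕜 := ℝ) v
  support_subset := (tsupport_fderiv_apply_subset ℝ v).trans h.support_subset

theorem integrable (h : IsTestFun Ω φ) : Integrable φ :=
  h.continuous.integrable_of_hasCompactSupport h.compactSupport

theorem exists_bound (h : IsTestFun Ω φ) : ∃ C, ∀ z, |φ z| ≤ C :=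
  h.continuous.bounded_above_of_compact_support h.compactSupport

theorem exists_radius (h : IsTestFun Ω φ) : ∃ L, ∀ z, L < ‖z‖ → φ z = 0 := by
  obtain ⟨L, hL⟩ := h.compactSupport.isCompact.isBounded.exists_norm_le
  exact ⟨L, fun z hz => image_eq_zero_of_notMem_tsupport fun h' => hz.not_ge (hL z h')⟩

theorem integrable_mul {f : ℂ → ℝ} (h : IsTestFun Ω φ) (hf : Integrable f) :
    Integrable fun z => φ z * f z := by
  obtain ⟨C, hC⟩ := h.exists_bound
  exact hf.bdd_mul h.continuous.aestronglyMeasurable (Filter.Eventually.of_forall hC)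

end IsTestFun

theorem IsCompact.exists_subset_Icc_of_subset_Ioo {C : Set ℝ} (hC : IsCompact C) {a b : ℝ}
    (h : C ⊆ Set.Ioo a b) : ∃ a' b', a < a' ∧ b' < b ∧ C ⊆ Set.Icc a' b' := by
  rcases C.eq_empty_or_nonempty with rfl | hne
  · exact ⟨a + 1, b - 1, by linarith, by linarith, Set.empty_subset _⟩
  · exact ⟨sInf C, sSup C, (h (hC.sInf_mem hne)).1, (h (hC.sSup_mem hne)).2, fun x hx =>
      ⟨csInf_le hC.bddBelow hx, le_csSup hC.bddAbove hx⟩⟩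

theorem exists_contDiff_integral_eq_one {a b : ℝ} (hab : a < b) : ∃ (ω : ℝ → ℝ) (α β : ℝ),
    a < α ∧ β < b ∧ ContDiff ℝ ((⊤ : ℕ∞) : WithTop ℕ∞) ω ∧ (∀ t, t ∉ Set.Icc α β → ω t = 0) ∧
    ∫ t, ω t = 1 := by
  let f : ContDiffBump ((a + b) / 2) := ⟨(b - a) / 8, (b - a) / 4, by linarith, by linarith⟩
  refine ⟨f.normed volume, (a + b) / 2 - (b - a) / 4, (a + b) / 2 + (b - a) / 4, by linarith,
    by linarith, f.contDiff_normed, fun t ht => ?_, f.integral_normed⟩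
  rw [← Real.closedBall_eq_Icc] at ht
  refine Function.notMem_support.1 fun h => ht ?_
  rw [f.support_normed_eq] at h
  exact Metric.ball_subset_closedBall h

section Rect

variable {a b c d α β : ℝ} {ω : ℝ → ℝ} {φ : ℂ → ℝ}

theorem IsTestFun.exists_rect (hφ : IsTestFun (Set.Ioo a b ×ℂ Set.Ioo c d) φ) :
    ∃ a' b' c' d', a < a' ∧ b' < b ∧ c < c' ∧ d' < d ∧
      ∀ z, ¬(z.re ∈ Set.Icc a' b' ∧ z.im ∈ Set.Icc c' d') → φ z = 0 := by
  obtain ⟨a', b', h1, h2, h3⟩ := (hφ.compactSupport.isCompact.image continuous_re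
    ).exists_subset_Icc_of_subset_Ioo (a := a) (b := b) (by
      rintro _ ⟨z, hz, rfl⟩
      exact (hφ.support_subset hz).1)
  obtain ⟨c', d', h4, h5, h6⟩ := (hφ.compactSupport.isCompact.image continuous_im
    ).exists_subset_Icc_of_subset_Ioo (a := c) (b := d) (by
      rintro _ ⟨z, hz, rfl⟩
      exact (hφ.support_subset hz).2)
  refine ⟨a', b', c', d', h1, h2, h4, h5, fun z hz => ?_⟩
  exact image_eq_zero_of_notMem_tsupport fun h => hz ⟨h3 ⟨z, h, rfl⟩, h6 ⟨z, h, rfl⟩⟩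

theorem exists_bound_of_Icc (hω0 : ∀ t, t ∉ Set.Icc α β → ω t = 0) :
    ∃ L, ∀ t, L < |t| → ω t = 0 := by
  refine ⟨max |α| |β|, fun t ht => hω0 t fun h => ht.not_ge ?_⟩
  exact abs_le_max_abs_abs h.1 h.2

theorem isTestFun_rayInt_re (hα : a < α) (hβ : β < b)
    (hω : ContDiff ℝ ((⊤ : ℕ∞) : WithTop ℕ∞) ω)
    (hω0 : ∀ t, t ∉ Set.Icc α β → ω t = 0) (hω1 : ∫ t, ω t = 1)
    (hφ : IsTestFun (Set.Ioo a b ×ℂ Set.Ioo c d) φ) :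
    IsTestFun (Set.Ioo a b ×ℂ Set.Ioo c d) (rayInt reCLM 1 ω φ) := by
  obtain ⟨a', b', c', d', ha, hb, hc, hd, h⟩ := hφ.exists_rect
  obtain ⟨L1, hL1⟩ := hφ.exists_radius
  obtain ⟨L2, hL2⟩ := exists_bound_of_Icc hω0
  refine IsTestFun.of_isCompact (contDiff_rayInt (L := max L1 L2) (by simp) hφ.smooth
    (fun z hz => hL1 z ((le_max_left _ _).trans_lt (hz.trans_le (abs_re_le_norm z)))) hω
    (fun t ht => hL2 t ((le_max_right _ _).trans_lt ht)))
    -- The support can grow only in the direction of integration, and no further than an interval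
    -- holding the supports of both `φ` and `ω`.
    (K := Set.Icc (min a' α) (max b' β) ×ℂ Set.Icc c' d')
    (isCompact_Icc.reProdIm isCompact_Icc) ?_ fun z hz => ?_
  · rintro z ⟨h1, h2⟩
    exact ⟨⟨(lt_min ha hα).trans_le h1.1, h1.2.trans_lt (max_lt hb hβ)⟩,
      hc.trans_le h2.1, h2.2.trans_lt hd⟩
  · refine rayInt_eq_zero (ℓ := reCLM) (m := imCLM) (by simp) (by simp) (fun w hw => ?_)
      (fun t ht => ?_) hω1 z hz
    · refine h w fun h' => hw ⟨⟨?_, ?_⟩, h'.2⟩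
      · exact (min_le_left _ _).trans h'.1.1
      · exact h'.1.2.trans (le_max_left _ _)
    · refine hω0 t fun h' => ht ⟨?_, ?_⟩
      · exact (min_le_right _ _).trans h'.1
      · exact h'.2.trans (le_max_right _ _)

theorem isTestFun_rayInt_im (hα : c < α) (hβ : β < d)
    (hω : ContDiff ℝ ((⊤ : ℕ∞) : WithTop ℕ∞) ω)
    (hω0 : ∀ t, t ∉ Set.Icc α β → ω t = 0) (hω1 : ∫ t, ω t = 1)
    (hφ : IsTestFun (Set.Ioo a b ×ℂ Set.Ioo c d) φ) :
    IsTestFun (Set.Ioo a b ×ℂ Set.Ioo c d) (rayInt imCLM I ω φ) := by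
  obtain ⟨a', b', c', d', ha, hb, hc, hd, h⟩ := hφ.exists_rect
  obtain ⟨L1, hL1⟩ := hφ.exists_radius
  obtain ⟨L2, hL2⟩ := exists_bound_of_Icc hω0
  refine IsTestFun.of_isCompact (contDiff_rayInt (L := max L1 L2) (by simp) hφ.smooth
    (fun z hz => hL1 z ((le_max_left _ _).trans_lt (hz.trans_le (abs_im_le_norm z)))) hω
    (fun t ht => hL2 t ((le_max_right _ _).trans_lt ht)))
    (K := Set.Icc a' b' ×ℂ Set.Icc (min c' α) (max d' β))
    (isCompact_Icc.reProdIm isCompact_Icc) ?_ fun z hz => ?_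
  · rintro z ⟨h1, h2⟩
    exact ⟨⟨ha.trans_le h1.1, h1.2.trans_lt hb⟩,
      (lt_min hc hα).trans_le h2.1, h2.2.trans_lt (max_lt hd hβ)⟩
  · refine rayInt_eq_zero (ℓ := imCLM) (m := reCLM) (by simp) (by simp) (fun w hw => ?_)
      (fun t ht => ?_) hω1 z fun h' => hz ⟨h'.2, h'.1⟩
    · refine h w fun h' => hw ⟨⟨?_, ?_⟩, h'.1⟩
      · exact (min_le_left _ _).trans h'.2.1
      · exact h'.2.2.trans (le_max_left _ _)
    · refine hω0 t fun h' => ht ⟨?_, ?_⟩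
      · exact (min_le_right _ _).trans h'.1
      · exact h'.2.trans (le_max_right _ _)

end Rect

/-! ### Weak primitives on a rectangle -/

/-- The primitive in the second variable of the average of `Q` in the first. -/
noncomputable def avgPrimitive (ω : ℝ → ℝ) (Q : ℂ → ℝ) (z : ℂ) : ℝ :=
  ∫ w, (if w.im < z.im then 1 else 0) * (ω w.re * Q w)

theorem abs_avgPrimitive_le {ω : ℝ → ℝ} {Q : ℂ → ℝ} (hQ : Integrable fun w => ω w.re * Q w)
    (z : ℂ) : |avgPrimitive ω Q z| ≤ ∫ w, |ω w.re * Q w| := by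
  refine norm_integral_le_of_norm_le (G := ℝ) hQ.norm (Filter.Eventually.of_forall fun w => ?_)
  split_ifs
  · simp
  · simp only [zero_mul, norm_zero]
    positivity

theorem stronglyMeasurable_avgPrimitive {ω : ℝ → ℝ} {Q : ℂ → ℝ}
    (hQ : Measurable fun w => ω w.re * Q w) : StronglyMeasurable (avgPrimitive ω Q) := by
  refine StronglyMeasurable.integral_prod_right (f := fun z w : ℂ =>
    (if w.im < z.im then (1 : ℝ) else 0) * (ω w.re * Q w)) (Measurable.stronglyMeasurable ?_)
  refine Measurable.mul (Measurable.ite (measurableSet_lt ?_ ?_) measurable_const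
    measurable_const) (hQ.comp measurable_snd)
  · exact measurable_im.comp measurable_snd
  · exact measurable_im.comp measurable_fst

theorem integral_mul_avgPrimitive {ω : ℝ → ℝ} {Q η : ℂ → ℝ}
    (hQ : Integrable fun w => ω w.re * Q w) (hη : Integrable η) :
    ∫ z, η z * avgPrimitive ω Q z =
      ∫ w, ω w.re * Q w * ∫ z, (if w.im < z.im then 1 else 0) * η z := by
  simp only [avgPrimitive, ← integral_const_mul]
  rw [integral_integral_swap]
  · congr 1
    funext w
    congr 1
    funext z
    ring
  · refine (hη.mul_prod hQ).mono ?_ (Filter.Eventually.of_forall fun q => ?_)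
    · refine hη.aestronglyMeasurable.comp_fst.mul (AEStronglyMeasurable.mul ?_
        hQ.aestronglyMeasurable.comp_snd)
      refine (Measurable.ite (measurableSet_lt ?_ ?_) measurable_const
        measurable_const).aestronglyMeasurable
      · exact measurable_im.comp measurable_snd
      · exact measurable_im.comp measurable_fst
    · simp only [Function.uncurry]
      split_ifs
      · simp
      · simp only [zero_mul, mul_zero, norm_zero]
        positivity

theorem integrable_step_mul {η : ℂ → ℝ} (hη : Integrable η) (s : ℝ) :
    Integrable fun z : ℂ => (if s < z.im then 1 else 0) * η z := by
  refine hη.bdd_mul (c := 1) (Measurable.aestronglyMeasurable (Measurable.ite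
    (measurableSet_lt measurable_const measurable_im) measurable_const measurable_const))
    (Filter.Eventually.of_forall fun z => ?_)
  split_ifs <;> simp

/-- With `integral_step_mul_fderiv_I`, this computes the weak gradient of `avgPrimitive`: it depends
on `y` only, and its `y`-derivative is the `ω`-average of `Q` along horizontal lines. -/
theorem integral_step_mul_fderiv_one {Ω : Set ℂ} {φ : ℂ → ℝ} (hφ : IsTestFun Ω φ) (s : ℝ) :
    ∫ z : ℂ, (if s < z.im then 1 else 0) * fderiv ℝ φ z 1 = 0 := by
  rw [integral_complex_eq_im_re (integrable_step_mul (hφ.fderiv_apply 1).integrable s)]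
  obtain ⟨L, hL⟩ := hφ.exists_radius
  have h : ∀ y : ℝ, ∫ x : ℝ, fderiv ℝ φ ⟨x, y⟩ 1 = 0 := by
    intro y
    rw [← lineInt_fderiv (ℓ := reCLM) (e := 1) (L := L) (by simp) hφ.contDiff_one
      (fun z hz => hL z (hz.trans_le (abs_re_le_norm z))) ⟨0, y⟩, lineInt]
    congr 1
    funext x
    congr 2
    apply Complex.ext <;> simp
  have h' : ∀ y : ℝ,
      ∫ x : ℝ, (if s < (⟨x, y⟩ : ℂ).im then 1 else 0) * fderiv ℝ φ ⟨x, y⟩ 1 = 0 := by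
    intro y
    change ∫ x : ℝ, (if s < y then 1 else 0) * fderiv ℝ φ ⟨x, y⟩ 1 = 0
    rw [integral_const_mul, h, mul_zero]
  simp only [h', integral_zero]

theorem integral_step_mul_fderiv_I {Ω : Set ℂ} {φ : ℂ → ℝ} (hφ : IsTestFun Ω φ) (w : ℂ) :
    ∫ z : ℂ, (if w.im < z.im then 1 else 0) * fderiv ℝ φ z I = -lineInt volume 1 φ w := by
  rw [integral_complex_eq_re_im (integrable_step_mul (hφ.fderiv_apply I).integrable _)]
  obtain ⟨L, hL⟩ := hφ.exists_radius
  have h : ∀ x : ℝ, ∫ y : ℝ, (if w.im < y then 1 else 0) * fderiv ℝ φ ⟨x, y⟩ I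
      = -φ ⟨x, w.im⟩ := by
    intro x
    rw [integral_step_mul (fun y => fderiv ℝ φ ⟨x, y⟩ I),
      ← lineInt_Ioi_fderiv (ℓ := imCLM) (e := I) (L := L) (by simp) hφ.contDiff_one
      (fun z hz => hL z (hz.trans_le (abs_im_le_norm z))) ⟨x, w.im⟩, lineInt]
    congr 1
    funext y
    congr 2
    apply Complex.ext <;> simp
  simp only [h, integral_neg]
  rw [lineInt, ← integral_add_left_eq_self _ w.re]
  congr 2
  funext x
  congr 1
  apply Complex.ext <;> simp

/-- The primitive of `P` in the first variable which has mean zero against `ω`. -/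
noncomputable def linePrimitive (ω : ℝ → ℝ) (P : ℂ → ℝ) (z : ℂ) : ℝ :=
  ∫ s, rayKernel ω z.re s * P ⟨s, z.im⟩

theorem continuous_tailInt {ω : ℝ → ℝ} (hω : ContDiff ℝ ((⊤ : ℕ∞) : WithTop ℕ∞) ω)
    {L : ℝ} (hωL : ∀ t, L < |t| → ω t = 0) : Continuous (tailInt ω) := by
  have h := (contDiff_tailInt (ℓ := reCLM) (e := 1) (by simp) hω hωL).continuous
  exact h.comp continuous_ofReal

theorem integrable_of_bounded_support {ω : ℝ → ℝ} (hω : Continuous ω) {L : ℝ}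
    (hωL : ∀ t, L < |t| → ω t = 0) : Integrable ω := by
  refine hω.integrable_of_hasCompactSupport (HasCompactSupport.intro
    (isCompact_Icc (a := -L) (b := L)) fun {t} ht => hωL t ?_)
  by_contra! h
  exact ht (abs_le.1 h)

theorem integral_mul_linePrimitive {ω : ℝ → ℝ} (hω : ContDiff ℝ ((⊤ : ℕ∞) : WithTop ℕ∞) ω)
    {L : ℝ} (hωL : ∀ t, L < |t| → ω t = 0) {P : ℂ → ℝ} (hP : Integrable P) {Ω : Set ℂ}
    {η : ℂ → ℝ} (hη : IsTestFun Ω η) :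
    ∫ z, η z * linePrimitive ω P z = ∫ w, P w * rayInt reCLM 1 ω η w := by
  obtain ⟨C, hC⟩ := hη.exists_bound
  obtain ⟨M, hM⟩ := hη.exists_radius
  have hM' : ∀ z, M < |z.re| → η z = 0 := fun z hz => hM z (hz.trans_le (abs_re_le_norm z))
  have := integral_lineKernel_mul (k := rayKernel ω)
    (measurable_rayKernel (continuous_tailInt hω hωL).measurable)
    (abs_rayKernel_le (integrable_of_bounded_support hω.continuous hωL)) hP
    hη.continuous.measurable hC hM'
  simp only [integral_rayKernel_mul hη.continuous hM'] at this
  exact this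

/-- Cauchy–Schwarz against the constant `1`. -/
theorem sq_lintegral_le {μ : Measure ℝ} {f : ℝ → ENNReal} (hf : AEMeasurable f μ) :
    (∫⁻ x, f x ∂μ) ^ 2 ≤ (∫⁻ x, f x ^ 2 ∂μ) * μ Set.univ := by
  have h := ENNReal.lintegral_mul_le_Lp_mul_Lq μ Real.HolderConjugate.two_two hf
    (aemeasurable_const (b := (1 : ENNReal)))
  simp only [Pi.mul_apply, mul_one, ENNReal.rpow_two, one_pow, lintegral_const, one_mul] at h
  calc (∫⁻ x, f x ∂μ) ^ 2
      ≤ ((∫⁻ x, f x ^ 2 ∂μ) ^ (1 / 2 : ℝ) * μ Set.univ ^ (1 / 2 : ℝ)) ^ 2 := by gcongr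
    _ = (∫⁻ x, f x ^ 2 ∂μ) * μ Set.univ := by
      rw [mul_pow, ← ENNReal.rpow_natCast, ← ENNReal.rpow_natCast, ← ENNReal.rpow_mul,
        ← ENNReal.rpow_mul]
      norm_num

/-- The kernel is bounded and `P` vanishes off the rectangle, so Cauchy–Schwarz on each horizontal
line bounds the square of the primitive by the line integral of `P²`, uniformly in `x`; integration
over the rectangle then costs only its width. -/
theorem memLp_linePrimitive {ω : ℝ → ℝ} (hω : ContDiff ℝ ((⊤ : ℕ∞) : WithTop ℕ∞) ω)
    {L : ℝ} (hωL : ∀ t, L < |t| → ω t = 0) {P : ℂ → ℝ} (hPm : Measurable P) (hP : MemLp P 2)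
    {a b c d : ℝ} (hP0 : ∀ z, z ∉ Set.Ioo a b ×ℂ Set.Ioo c d → P z = 0) :
    MemLp (linePrimitive ω P) 2 (volume.restrict (Set.Ioo a b ×ℂ Set.Ioo c d)) := by
  have hk := measurable_rayKernel (continuous_tailInt hω hωL).measurable
  have hB := abs_rayKernel_le (integrable_of_bounded_support hω.continuous hωL)
  set B := 1 + ∫ t, |ω t| with hBdef
  have hm : StronglyMeasurable (linePrimitive ω P) := by
    refine StronglyMeasurable.integral_prod_right (f := fun (z : ℂ) (s : ℝ) =>
      rayKernel ω z.re s * P ⟨s, z.im⟩) (Measurable.stronglyMeasurable ?_)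
    exact (hk.comp (f := fun q : ℂ × ℝ => (q.1.re, q.2))
      ((measurable_re.comp measurable_fst).prodMk measurable_snd)).mul
      (hPm.comp measurePreserving_lineSwap.measurable.fst)
  refine ⟨hm.aestronglyMeasurable, ?_⟩
  have hfin : ∫⁻ z, ‖P z‖ₑ ^ 2 < ⊤ := by
    have := (eLpNorm_lt_top_iff_lintegral_rpow_enorm_lt_top (p := 2) (by simp) (by simp)).1 hP.2
    simpa using this
  rw [eLpNorm_lt_top_iff_lintegral_rpow_enorm_lt_top (by simp) (by simp)]
  simp only [ENNReal.toReal_ofNat, ENNReal.rpow_two]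
  let V : ENNReal := volume (Set.Ioo a b)
  have hV : V < ⊤ := measure_Ioo_lt_top
  have hpt : ∀ z : ℂ, ‖linePrimitive ω P z‖ₑ ^ 2 ≤
      ENNReal.ofReal B ^ 2 * V * ∫⁻ s : ℝ, ‖P ⟨s, z.im⟩‖ₑ ^ 2 := by
    intro z
    have hPz : Measurable fun s : ℝ => ‖P ⟨s, z.im⟩‖ₑ :=
      (hPm.comp (continuous_mk_left z.im).measurable).enorm
    have h1 : ‖linePrimitive ω P z‖ₑ ≤ ENNReal.ofReal B * ∫⁻ s : ℝ, ‖P ⟨s, z.im⟩‖ₑ := by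
      rw [← lintegral_const_mul _ hPz]
      refine (enorm_integral_le_lintegral_enorm _).trans (lintegral_mono fun s => ?_)
      rw [enorm_mul]
      gcongr
      rw [← ofReal_norm]
      exact ENNReal.ofReal_le_ofReal (hB _ _)
    have h2 : ∫⁻ s : ℝ, ‖P ⟨s, z.im⟩‖ₑ = ∫⁻ s in Set.Ioo a b, ‖P ⟨s, z.im⟩‖ₑ := by
      rw [← lintegral_indicator measurableSet_Ioo]
      congr 1
      funext s
      by_cases hs : s ∈ Set.Ioo a b
      · rw [Set.indicator_of_mem hs]
      · rw [Set.indicator_of_notMem hs, hP0 _ fun h => hs h.1, enorm_zero]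
    calc ‖linePrimitive ω P z‖ₑ ^ 2
        ≤ (ENNReal.ofReal B * ∫⁻ s in Set.Ioo a b, ‖P ⟨s, z.im⟩‖ₑ) ^ 2 := by
          rw [← h2]
          gcongr
      _ = ENNReal.ofReal B ^ 2 * (∫⁻ s in Set.Ioo a b, ‖P ⟨s, z.im⟩‖ₑ) ^ 2 := mul_pow _ _ _
      _ ≤ ENNReal.ofReal B ^ 2 * ((∫⁻ s in Set.Ioo a b, ‖P ⟨s, z.im⟩‖ₑ ^ 2) * V) := by
          gcongr
          refine (sq_lintegral_le hPz.aemeasurable).trans_eq ?_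
          rw [Measure.restrict_apply_univ]
      _ ≤ ENNReal.ofReal B ^ 2 * ((∫⁻ s : ℝ, ‖P ⟨s, z.im⟩‖ₑ ^ 2) * V) := by
          gcongr
          exact Measure.restrict_le_self
      _ = _ := by ring
  have hS : MeasurableSet (Set.Ioo a b ×ℂ Set.Ioo c d) :=
    (isOpen_Ioo.reProdIm isOpen_Ioo).measurableSet
  have hg : Measurable fun z : ℂ => ∫⁻ s : ℝ, ‖P ⟨s, z.im⟩‖ₑ ^ 2 := by
    refine Measurable.lintegral_prod_right' (f := fun q : ℂ × ℝ => ‖P ⟨q.2, q.1.im⟩‖ₑ ^ 2) ?_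
    exact ((hPm.comp measurePreserving_lineSwap.measurable.fst).enorm).pow_const 2
  calc ∫⁻ z in Set.Ioo a b ×ℂ Set.Ioo c d, ‖linePrimitive ω P z‖ₑ ^ 2
      ≤ ∫⁻ z in Set.Ioo a b ×ℂ Set.Ioo c d,
          ENNReal.ofReal B ^ 2 * V * ∫⁻ s : ℝ, ‖P ⟨s, z.im⟩‖ₑ ^ 2 := lintegral_mono hpt
    _ = ENNReal.ofReal B ^ 2 * V * ∫⁻ z in Set.Ioo a b ×ℂ Set.Ioo c d,
          ∫⁻ s : ℝ, ‖P ⟨s, z.im⟩‖ₑ ^ 2 := lintegral_const_mul _ hg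
    _ ≤ ENNReal.ofReal B ^ 2 * V * ∫⁻ z : ℂ, (Set.Ioo a b).indicator 1 z.re *
          ∫⁻ s : ℝ, ‖P ⟨s, z.im⟩‖ₑ ^ 2 := by
        refine mul_le_mul_right ?_ _
        rw [← lintegral_indicator hS]
        refine lintegral_mono fun z => ?_
        by_cases hz : z ∈ Set.Ioo a b ×ℂ Set.Ioo c d
        · have hz1 : z.re ∈ Set.Ioo a b := hz.1
          rw [Set.indicator_of_mem hz, Set.indicator_of_mem hz1]
          simp
        · rw [Set.indicator_of_notMem hz]
          exact zero_le
    _ = ENNReal.ofReal B ^ 2 * V * (V * ∫⁻ z : ℂ, ‖P z‖ₑ ^ 2) := by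
        congr 1
        have hi : Measurable fun z : ℂ => (Set.Ioo a b).indicator (1 : ℝ → ENNReal) z.re :=
          (measurable_one.indicator measurableSet_Ioo).comp measurable_re
        have h3 := lintegral_complex_eq_im_re (hi.mul hg)
        simp only [Pi.mul_apply] at h3
        rw [h3, lintegral_complex_eq_im_re (hPm.enorm.pow_const 2),
          ← lintegral_const_mul' _ _ hV.ne]
        congr 1
        funext y
        rw [lintegral_mul_const _ (measurable_one.indicator measurableSet_Ioo),
          lintegral_indicator_one measurableSet_Ioo]
    _ < ⊤ := ENNReal.mul_lt_top (ENNReal.mul_lt_top (by simp) hV) (ENNReal.mul_lt_top hV hfin)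

section Rect

variable {a b c d : ℝ}

theorem volume_rect_lt_top : volume (Set.Ioo a b ×ℂ Set.Ioo c d) < ⊤ :=
  ((Metric.isBounded_Ioo a b).reProdIm (Metric.isBounded_Ioo c d)).measure_lt_top

theorem MeasureTheory.MemLp.integrable_of_eq_zero {S : Set ℂ} (hS : volume S < ⊤) {P : ℂ → ℝ}
    (hP : MemLp P 2) (hP0 : ∀ z, z ∉ S → P z = 0) : Integrable P := by
  have : IsFiniteMeasure (volume.restrict S) := ⟨by simpa using hS⟩
  have h1 : IntegrableOn P S := (hP.restrict S).integrable (by norm_num)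
  refine (integrableOn_iff_integrable_of_support_subset fun z hz => ?_).1 h1
  by_contra h
  exact hz (hP0 z h)

theorem IsTestFun.integrable_mul_of_integrableOn {Ω : Set ℂ} {φ f : ℂ → ℝ} (h : IsTestFun Ω φ)
    (hf : IntegrableOn f (tsupport φ)) : Integrable fun z => φ z * f z := by
  obtain ⟨C, hC⟩ := h.exists_bound
  refine (integrableOn_iff_integrable_of_support_subset (s := tsupport φ) fun z hz => ?_).1
    (hf.bdd_mul h.continuous.aestronglyMeasurable (Filter.Eventually.of_forall hC))
  exact subset_tsupport _ (left_ne_zero_of_mul hz)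

/-- A square integrable, weakly closed field on a rectangle has a weak primitive. -/
theorem exists_weak_primitive_rect (hab : a < b) {P Q : ℂ → ℝ} (hPm : Measurable P)
    (hQm : Measurable Q) (hP : MemLp P 2) (hQ : MemLp Q 2)
    (hP0 : ∀ z, z ∉ Set.Ioo a b ×ℂ Set.Ioo c d → P z = 0)
    (hQ0 : ∀ z, z ∉ Set.Ioo a b ×ℂ Set.Ioo c d → Q z = 0)
    (h : ∀ φ, IsTestFun (Set.Ioo a b ×ℂ Set.Ioo c d) φ →
      ∫ z, fderiv ℝ φ z I * P z = ∫ z, fderiv ℝ φ z 1 * Q z) :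
    ∃ v : ℂ → ℝ, MemLp v 2 (volume.restrict (Set.Ioo a b ×ℂ Set.Ioo c d)) ∧
      ∀ φ, IsTestFun (Set.Ioo a b ×ℂ Set.Ioo c d) φ →
        ∫ z, fderiv ℝ φ z 1 * v z = -∫ z, φ z * P z ∧
        ∫ z, fderiv ℝ φ z I * v z = -∫ z, φ z * Q z := by
  obtain ⟨ω, α, β, hα, hβ, hω, hω0, hω1⟩ := exists_contDiff_integral_eq_one hab
  obtain ⟨L, hωL⟩ := exists_bound_of_Icc hω0
  have hPi := hP.integrable_of_eq_zero volume_rect_lt_top hP0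
  have hQi := hQ.integrable_of_eq_zero volume_rect_lt_top hQ0
  obtain ⟨C, hC⟩ : ∃ C, ∀ t, ‖ω t‖ ≤ C :=
    hω.continuous.bounded_above_of_compact_support
      (HasCompactSupport.intro isCompact_Icc fun {t} ht => hω0 t ht)
  have hωm : Measurable fun w : ℂ => ω w.re := hω.continuous.measurable.comp measurable_re
  have hωQ : Integrable fun w => ω w.re * Q w :=
    hQi.bdd_mul hωm.aestronglyMeasurable (Filter.Eventually.of_forall fun w => hC w.re)
  have : IsFiniteMeasure (volume.restrict (Set.Ioo a b ×ℂ Set.Ioo c d)) :=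
    ⟨by simpa using volume_rect_lt_top⟩
  have hu := memLp_linePrimitive hω hωL hPm hP hP0
  have hv : MemLp (avgPrimitive ω Q) 2 (volume.restrict (Set.Ioo a b ×ℂ Set.Ioo c d)) :=
    MemLp.of_bound (stronglyMeasurable_avgPrimitive (hωm.mul hQm)).aestronglyMeasurable _
      (Filter.Eventually.of_forall fun z => abs_avgPrimitive_le hωQ z)
  -- The first summand has `x`-derivative `P` but is normalised to have `ω`-mean zero on every
  -- horizontal line. The second restores the mean, whose `y`-derivative must be the `ω`-mean of
  -- `Q`.
  refine ⟨fun z => linePrimitive ω P z + avgPrimitive ω Q z, hu.add hv, fun φ hφ => ?_⟩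
  have hsplit : ∀ η, IsTestFun (Set.Ioo a b ×ℂ Set.Ioo c d) η →
      ∫ z, η z * (linePrimitive ω P z + avgPrimitive ω Q z) =
        (∫ w, P w * rayInt reCLM 1 ω η w) +
        ∫ w, ω w.re * Q w * ∫ z, (if w.im < z.im then 1 else 0) * η z := by
    intro η hη
    rw [← integral_mul_linePrimitive hω hωL hPi hη, ← integral_mul_avgPrimitive hωQ hη.integrable,
      ← integral_add]
    · simp only [mul_add]
    · exact hη.integrable_mul_of_integrableOn
        (IntegrableOn.mono_set (hu.integrable (by norm_num)) hη.support_subset)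
    · exact hη.integrable_mul_of_integrableOn
        (IntegrableOn.mono_set (hv.integrable (by norm_num)) hη.support_subset)
  obtain ⟨M, hM⟩ := hφ.exists_radius
  have hM' : ∀ z, max M L < |reCLM z| → φ z = 0 := fun z hz =>
    hM z (((le_max_left _ _).trans_lt hz).trans_le (abs_re_le_norm z))
  have hωM : ∀ t, max M L < |t| → ω t = 0 := fun t ht => hωL t ((le_max_right _ _).trans_lt ht)
  have he : reCLM (1 : ℂ) = 1 := by simp
  constructor
  · rw [hsplit _ (hφ.fderiv_apply 1)]
    simp only [rayInt_fderiv he hφ.contDiff_one hM', integral_step_mul_fderiv_one hφ, mul_zero,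
      integral_zero, add_zero, mul_neg, integral_neg]
    simp only [mul_comm]
  · rw [hsplit _ (hφ.fderiv_apply I)]
    -- Closedness is tested on the antiderivative `rayInt reCLM 1 ω φ`. Its `x`-derivative is `-φ`
    -- plus `ω` times the line integral of `φ`, and this last term cancels against `avgPrimitive`.
    have hψ := isTestFun_rayInt_re hα hβ hω hω0 hω1 hφ
    have h1 := h _ hψ
    have h2 := (hψ.fderiv_apply 1).integrable_mul hQi
    simp only [fderiv_rayInt_apply he hφ.contDiff_one hM' hω hωM, rayInt_fderiv he
      hφ.contDiff_one hM'] at h1 h2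
    simp only [integral_step_mul_fderiv_I hφ]
    simp only [reCLM_apply, I_re, one_re, mul_zero, zero_mul, add_zero, mul_one] at h1 h2
    simp only [mul_comm (P _), h1]
    rw [← integral_add h2, ← integral_neg]
    · congr 1
      funext z
      ring
    · refine ((hφ.integrable_mul hQi).neg.sub h2).congr (Filter.Eventually.of_forall fun z => ?_)
      simp only [Pi.sub_apply, Pi.neg_apply]
      ring

end Rect

/-! ### Uniqueness of weak primitives up to constants -/

theorem IsTestFun.add {Ω : Set ℂ} {φ ψ : ℂ → ℝ} (hφ : IsTestFun Ω φ) (hψ : IsTestFun Ω ψ) :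
    IsTestFun Ω fun z => φ z + ψ z where
  smooth := hφ.smooth.add hψ.smooth
  compactSupport := hφ.compactSupport.add hψ.compactSupport
  support_subset := (tsupport_add φ ψ).trans
    (Set.union_subset hφ.support_subset hψ.support_subset)

theorem integral_lineInt_I {Ω : Set ℂ} {φ : ℂ → ℝ} (hφ : IsTestFun Ω φ) (z : ℂ) :
    ∫ t : ℝ, lineInt volume 1 φ (z + t • I) = ∫ w, φ w := by
  rw [integral_complex_eq_im_re hφ.integrable,
    ← integral_add_left_eq_self (fun y : ℝ => ∫ x : ℝ, φ ⟨x, y⟩) z.im]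
  congr 1
  funext t
  rw [lineInt, ← integral_add_left_eq_self (fun x : ℝ => φ ⟨x, z.im + t⟩) z.re]
  congr 1
  funext s
  congr 1
  apply Complex.ext <;> simp

/-- A function on a rectangle whose weak gradient vanishes is almost everywhere constant. -/
theorem ae_eq_const_of_weak_grad_eq_zero {a b c d : ℝ} {v : ℂ → ℝ}
    (hv : IntegrableOn v (Set.Ioo a b ×ℂ Set.Ioo c d))
    (h : ∀ φ, IsTestFun (Set.Ioo a b ×ℂ Set.Ioo c d) φ →
      ∫ z, fderiv ℝ φ z 1 * v z = 0 ∧ ∫ z, fderiv ℝ φ z I * v z = 0) :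
    ∃ C : ℝ, ∀ᵐ z, z ∈ Set.Ioo a b ×ℂ Set.Ioo c d → v z = C := by
  rcases le_or_gt b a with hab | hab
  · exact ⟨0, Filter.Eventually.of_forall fun z hz => by
      simp [Set.Ioo_eq_empty_of_le hab, mem_reProdIm] at hz⟩
  rcases le_or_gt d c with hcd | hcd
  · exact ⟨0, Filter.Eventually.of_forall fun z hz => by
      simp [Set.Ioo_eq_empty_of_le hcd, mem_reProdIm] at hz⟩
  obtain ⟨ω, α, β, hα, hβ, hω, hω0, hω1⟩ := exists_contDiff_integral_eq_one hab
  obtain ⟨χ, α', β', hα', hβ', hχ, hχ0, hχ1⟩ := exists_contDiff_integral_eq_one hcd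
  obtain ⟨L1, hωL⟩ := exists_bound_of_Icc hω0
  obtain ⟨L2, hχL⟩ := exists_bound_of_Icc hχ0
  have hint : ∀ η, IsTestFun (Set.Ioo a b ×ℂ Set.Ioo c d) η → Integrable fun z => η z * v z :=
    fun η hη => hη.integrable_mul_of_integrableOn (hv.mono_set hη.support_subset)
  set C := ∫ z, χ (imCLM z) * ω (reCLM z) * v z with hC
  -- Modulo an `x`-derivative of a test function, `φ` is `ω(x)` times its horizontal integral;
  -- modulo a further `y`-derivative, it is `ω(x) χ(y) ∫ φ`. Since `v` annihilates both derivatives,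
  -- `v - C` annihilates every test function.
  have key : ∀ φ, IsTestFun (Set.Ioo a b ×ℂ Set.Ioo c d) φ →
      ∫ z, φ z * v z = (∫ z, φ z) * C := by
    intro φ hφ
    obtain ⟨M, hM⟩ := hφ.exists_radius
    have hψ := (isTestFun_rayInt_re hα hβ hω hω0 hω1 hφ)
    have d1 : ∀ z, fderiv ℝ (rayInt reCLM 1 ω φ) z 1 =
        -φ z + ω (reCLM z) * lineInt volume 1 φ z := by
      intro z
      have hM' : ∀ z, max M L1 < |reCLM z| → φ z = 0 := fun z hz =>
        hM z (((le_max_left _ _).trans_lt hz).trans_le (abs_re_le_norm z))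
      rw [fderiv_rayInt_apply (L := max M L1) (by simp) hφ.contDiff_one hM' hω
        (fun t ht => hωL t ((le_max_right _ _).trans_lt ht)),
        rayInt_fderiv (L := max M L1) (by simp) hφ.contDiff_one hM']
      simp
    have e1 := (h _ hψ).1
    have i1 := hint _ (hψ.fderiv_apply 1)
    have hφ2 := hφ.add (hψ.fderiv_apply 1)
    simp only [d1, add_neg_cancel_left] at e1 i1 hφ2
    have s1 : ∫ z, φ z * v z = ∫ z, ω (reCLM z) * lineInt volume 1 φ z * v z := by
      rw [← add_zero (∫ z, φ z * v z), ← e1, ← integral_add (hint _ hφ) i1]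
      congr 1
      funext z
      ring
    obtain ⟨M2, hM2⟩ := hφ2.exists_radius
    have hψ2 := (isTestFun_rayInt_im hα' hβ' hχ hχ0 hχ1 hφ2)
    have n2 : ∀ z, lineInt volume I (fun w => ω (reCLM w) * lineInt volume 1 φ w) z =
        ω (reCLM z) * ∫ w, φ w := by
      intro z
      rw [← integral_lineInt_I hφ z, ← integral_const_mul, lineInt]
      congr 1
      funext t
      simp
    have d2 : ∀ z, fderiv ℝ (rayInt imCLM I χ
        fun z => ω (reCLM z) * lineInt volume 1 φ z) z I =
        -(ω (reCLM z) * lineInt volume 1 φ z) +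
          χ (imCLM z) * (ω (reCLM z) * ∫ w, φ w) := by
      intro z
      have hM' : ∀ z, max M2 L2 < |imCLM z| → ω (reCLM z) * lineInt volume 1 φ z = 0 :=
        fun z hz => hM2 z (((le_max_left _ _).trans_lt hz).trans_le (abs_im_le_norm z))
      rw [fderiv_rayInt_apply (L := max M2 L2) (by simp) hφ2.contDiff_one hM' hχ
        (fun t ht => hχL t ((le_max_right _ _).trans_lt ht)),
        rayInt_fderiv (L := max M2 L2) (by simp) hφ2.contDiff_one hM', n2]
      simp
    have e2 := (h _ hψ2).2
    have i2 := hint _ (hψ2.fderiv_apply I)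
    simp only [d2] at e2 i2
    rw [s1, ← add_zero (∫ z, ω (reCLM z) * lineInt volume 1 φ z * v z), ← e2,
      ← integral_add (hint _ hφ2) i2, hC, ← integral_const_mul]
    congr 1
    funext z
    ring
  refine ⟨C, ?_⟩
  have hO : IsOpen (Set.Ioo a b ×ℂ Set.Ioo c d) := isOpen_Ioo.reProdIm isOpen_Ioo
  have hloc : LocallyIntegrableOn (fun z => v z - C) (Set.Ioo a b ×ℂ Set.Ioo c d) :=
    (hv.sub (integrableOn_const volume_rect_lt_top.ne)).locallyIntegrableOn
  have h0 := hO.ae_eq_zero_of_integral_contDiff_smul_eq_zero hloc fun g hg hgc hgs => by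
    have hg' : IsTestFun (Set.Ioo a b ×ℂ Set.Ioo c d) g := ⟨hg, hgc, hgs⟩
    simp only [smul_eq_mul, mul_sub]
    rw [integral_sub (hint g hg') (hg'.integrable.mul_const C), key g hg', integral_mul_const,
      sub_self]
  filter_upwards [h0] with z hz hzR
  have := hz hzR
  linarith

/-! ### Gluing by covering space theory -/

/-- On a simply connected space a locally constant cocycle with values in a group is a
coboundary. -/
theorem exists_coboundary {B : Type*} [TopologicalSpace B] [SimplyConnectedSpace B]
    [LocallyPathConnectedSpace B] {F : Type*} [AddCommGroup F] {ι : Type*} (U : ι → Set B)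
    (hU : ∀ i, IsOpen (U i)) (hUc : ∀ i, IsPreconnected (U i)) (idx : B → ι)
    (hidx : ∀ x, x ∈ U (idx x)) (c : ι → ι → F) (hc0 : ∀ i, (U i).Nonempty → c i i = 0)
    (hc : ∀ i j k, (U i ∩ U j ∩ U k).Nonempty → c i j + c j k = c i k) :
    ∃ d : ι → F, ∀ i j, (U i ∩ U j).Nonempty → d j = d i + c i j := by
  -- With the discrete topology on the fibre, translations by the cocycle are continuous transition
  -- maps and the bundle is a covering.
  let _ : TopologicalSpace F := ⊥
  have _ : DiscreteTopology F := ⟨rfl⟩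
  let Z : FiberBundleCore ι B F :=
    { baseSet := U
      isOpen_baseSet := hU
      indexAt := idx
      mem_baseSet_at := hidx
      coordChange := fun i j _ v => v + c i j
      coordChange_self := fun i x hx v => by rw [hc0 i ⟨x, hx⟩, add_zero]
      continuousOn_coordChange := fun i j =>
        ((continuous_of_discreteTopology (f := fun v : F => v + c i j)).comp
          continuous_snd).continuousOn
      coordChange_comp := fun i j k x hx v => by rw [add_assoc, hc i j k ⟨x, hx⟩] }
  have cov : IsCoveringMap (Bundle.TotalSpace.proj : Bundle.TotalSpace F Z.Fiber → B) :=
    FiberBundle.isCoveringMap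
  obtain ⟨x₀⟩ : Nonempty B := inferInstance
  -- The lift of the identity is a global section. Read in the chart over `U i` it is constant,
  -- since `U i` is preconnected, and this constant is `d i`.
  obtain ⟨s, ⟨-, hs⟩, -⟩ := cov.existsUnique_continuousMap_lifts (ContinuousMap.id B) x₀
    (⟨x₀, (0 : F)⟩ : Bundle.TotalSpace F Z.Fiber) rfl
  have hs' : ∀ x, (s x).proj = x := fun x => congrFun hs x
  have hcont : ∀ i, ContinuousOn (fun x => (Z.localTriv i (s x)).2) (U i) := by
    intro i
    have h1 : ContinuousOn (Z.localTriv i) (Z.localTriv i).source :=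
      (Z.localTriv i).continuousOn_toFun
    refine continuous_snd.comp_continuousOn (h1.comp s.continuous.continuousOn fun x hx => ?_)
    rw [FiberBundleCore.mem_localTriv_source]
    change (s x).proj ∈ U i
    rwa [hs']
  have hconst : ∀ i, ∀ x ∈ U i, ∀ y ∈ U i,
      (Z.localTriv i (s x)).2 = (Z.localTriv i (s y)).2 := fun i x hx y hy =>
    (hUc i).constant (hcont i) hx hy
  have hchange : ∀ i j, ∀ x ∈ U i ∩ U j,
      (Z.localTriv j (s x)).2 = (Z.localTriv i (s x)).2 + c i j := by
    intro i j x hx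
    have e : ∀ k, (Z.localTriv k (s x)).2 = (show F from (s x).2) + c (idx (s x).proj) k :=
      fun k => rfl
    rw [e, e, add_assoc, hc _ i j ⟨x, ⟨?_, hx.1⟩, hx.2⟩]
    rw [hs' x]
    exact hidx x
  classical
  refine ⟨fun i => if h : (U i).Nonempty then (Z.localTriv i (s h.some)).2 else 0,
    fun i j ⟨x, hx⟩ => ?_⟩
  have hi : (U i).Nonempty := ⟨x, hx.1⟩
  have hj : (U j).Nonempty := ⟨x, hx.2⟩
  simp only [dif_pos hi, dif_pos hj]
  rw [hconst i _ hi.some_mem x hx.1, hconst j _ hj.some_mem x hx.2, hchange i j x hx]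

/-! ### Local square integrability and partitions of unity -/

section L2loc

variable {F : Type*} [NormedAddCommGroup F] {Ω : Set ℂ} {f : ℂ → F}

theorem memLp_two_restrict_union {S T : Set ℂ} (hS : MemLp f 2 (volume.restrict S))
    (hT : MemLp f 2 (volume.restrict T)) : MemLp f 2 (volume.restrict (S ∪ T)) := by
  refine ⟨aestronglyMeasurable_union_iff.2 ⟨hS.1, hT.1⟩, ?_⟩
  have h1 := (eLpNorm_lt_top_iff_lintegral_rpow_enorm_lt_top (p := 2) (by simp) (by simp)).1 hS.2
  have h2 := (eLpNorm_lt_top_iff_lintegral_rpow_enorm_lt_top (p := 2) (by simp) (by simp)).1 hT.2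
  exact (eLpNorm_lt_top_iff_lintegral_rpow_enorm_lt_top (by simp) (by simp)).2
    ((lintegral_union_le _ _ _).trans_lt (ENNReal.add_lt_top.2 ⟨h1, h2⟩))

theorem memL2loc_of_forall_mem_nhds (h : ∀ z ∈ Ω, ∃ U ∈ nhds z, MemLp f 2 (volume.restrict U)) :
    MemL2loc Ω f := by
  intro C hC hCΩ
  refine hC.induction_on (p := fun S => MemLp f 2 (volume.restrict S)) (by simp)
    (fun S T hST hT => hT.mono_measure (Measure.restrict_mono hST le_rfl))
    (fun S T => memLp_two_restrict_union) fun z hz => ?_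
  obtain ⟨U, hU, hf⟩ := h z (hCΩ hz)
  exact ⟨U, mem_nhdsWithin_of_mem_nhds hU, hf⟩

theorem MemL2loc.integrableOn (h : MemL2loc Ω f) {C : Set ℂ} (hC : IsCompact C) (hCΩ : C ⊆ Ω) :
    IntegrableOn f C := by
  have : IsFiniteMeasure (volume.restrict C) := ⟨by simpa using hC.measure_lt_top⟩
  exact (h C hC hCΩ).integrable (by norm_num)

theorem MemL2loc.locallyIntegrableOn (h : MemL2loc Ω f) (hΩ : IsOpen Ω) :
    LocallyIntegrableOn f Ω :=
  (locallyIntegrableOn_iff hΩ.isLocallyClosed).2 fun _ hk hkc => h.integrableOn hkc hk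

theorem MemL2loc.aestronglyMeasurable (h : MemL2loc Ω f) (hΩ : IsOpen Ω) :
    AEStronglyMeasurable f (volume.restrict Ω) :=
  (h.locallyIntegrableOn hΩ).aestronglyMeasurable

theorem IsTestFun.integrable_mul_of_memL2loc {φ g : ℂ → ℝ} (h : IsTestFun Ω φ)
    (hg : MemL2loc Ω g) : Integrable fun z => φ z * g z :=
  h.integrable_mul_of_integrableOn (hg.integrableOn h.compactSupport.isCompact h.support_subset)

theorem IsTestFun.setIntegral_mul {φ : ℂ → ℝ} (h : IsTestFun Ω φ) (g : ℂ → ℝ) :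
    ∫ z in Ω, φ z * g z = ∫ z, φ z * g z :=
  setIntegral_eq_integral_of_forall_compl_eq_zero fun z hz => by rw [h.eq_zero hz, zero_mul]

end L2loc

theorem IsTestFun.integral_fderiv {Ω : Set ℂ} {φ : ℂ → ℝ} (hφ : IsTestFun Ω φ) (e : ℂ) :
    ∫ z, fderiv ℝ φ z e = 0 := by
  have := integral_mul_fderiv_eq_neg_fderiv_mul_of_integrable (μ := volume)
    (f := fun _ : ℂ => (1 : ℝ)) (g := φ) (v := e) (by simp)
    (by simpa using (hφ.fderiv_apply e).integrable) (by simpa using hφ.integrable) (by fun_prop)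
    (fun x _ => hφ.contDiff_one.differentiable one_ne_zero x)
  simpa using this

theorem IsTestFun.exists_eq_sum {Ω : Set ℂ} {φ : ℂ → ℝ} (hφ : IsTestFun Ω φ) {ι : Type}
    (R : ι → Set ℂ) (hR : ∀ i, IsOpen (R i)) (hΩ : Ω ⊆ ⋃ i, R i) :
    ∃ (s : Finset ι) (ψ : s → ℂ → ℝ), (∀ i : s, IsTestFun (R i) (ψ i)) ∧
      φ = fun z => ∑ i, ψ i z := by
  obtain ⟨s, hs⟩ := hφ.compactSupport.isCompact.elim_finite_subcover R hR
    (hφ.support_subset.trans hΩ)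
  obtain ⟨f, hf⟩ := SmoothPartitionOfUnity.exists_isSubordinate 𝓘(ℝ, ℂ)
    (isClosed_tsupport φ) (fun i : s => R i) (fun i => hR i) (by
      intro z hz
      obtain ⟨i, hi, hzi⟩ := Set.mem_iUnion₂.1 (hs hz)
      exact Set.mem_iUnion.2 ⟨⟨i, hi⟩, hzi⟩)
  refine ⟨s, fun i z => f i z * φ z, fun i : s => ⟨?_, ?_, ?_⟩, ?_⟩
  · exact (f i).contMDiff.contDiff.mul hφ.smooth
  · exact hφ.compactSupport.mul_left
  · exact (tsupport_mul_subset_left).trans (hf i)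
  · funext z
    rw [← Finset.sum_mul]
    by_cases hz : z ∈ tsupport φ
    · have := f.sum_eq_one hz
      rw [finsum_eq_sum_of_fintype] at this
      rw [this, one_mul]
    · rw [image_eq_zero_of_notMem_tsupport hz, mul_zero]

/-- Weak derivatives are local: a partition of unity splits the test function, and both sides are
linear in it. -/
theorem integral_fderiv_mul_eq_of_cover {Ω : Set ℂ} {v P : ℂ → ℝ} (hv : MemL2loc Ω v)
    (hP : MemL2loc Ω P) (e : ℂ) {ι : Type} (R : ι → Set ℂ) (hR : ∀ i, IsOpen (R i))
    (hRΩ : ∀ i, R i ⊆ Ω) (hΩ : Ω ⊆ ⋃ i, R i)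
    (h : ∀ i φ, IsTestFun (R i) φ → ∫ z, fderiv ℝ φ z e * v z = -∫ z, φ z * P z)
    {φ : ℂ → ℝ} (hφ : IsTestFun Ω φ) : ∫ z, fderiv ℝ φ z e * v z = -∫ z, φ z * P z := by
  obtain ⟨s, ψ, hψ, rfl⟩ := hφ.exists_eq_sum R hR hΩ
  have hψΩ : ∀ i, IsTestFun Ω (ψ i) := fun i => (hψ i).mono (hRΩ _)
  have hd : ∀ z, fderiv ℝ (fun z => ∑ i, ψ i z) z e = ∑ i, fderiv ℝ (ψ i) z e := by
    intro z
    rw [fderiv_fun_sum fun i _ => (hψ i).contDiff_one.differentiable one_ne_zero z]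
    simp
  simp only [hd, Finset.sum_mul]
  rw [integral_finsetSum _ fun i _ => ((hψΩ i).fderiv_apply e).integrable_mul_of_memL2loc hv,
    integral_finsetSum _ fun i _ => (hψΩ i).integrable_mul_of_memL2loc hP,
    ← Finset.sum_neg_distrib]
  exact Finset.sum_congr rfl fun i _ => h i _ (hψ i)

/-! ### The weak Poincaré lemma -/

/-- The open square with centre `z` and half side `r`. -/
def square (z : ℂ) (r : ℝ) : Set ℂ :=
  Set.Ioo (z.re - r) (z.re + r) ×ℂ Set.Ioo (z.im - r) (z.im + r)

theorem isOpen_square (z : ℂ) (r : ℝ) : IsOpen (square z r) := isOpen_Ioo.reProdIm isOpen_Ioo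

theorem mem_square_self (z : ℂ) {r : ℝ} (hr : 0 < r) : z ∈ square z r :=
  ⟨⟨by linarith, by linarith⟩, ⟨by linarith, by linarith⟩⟩

theorem exists_closed_square_subset {Ω : Set ℂ} (hΩ : IsOpen Ω) {z : ℂ} (hz : z ∈ Ω) :
    ∃ r > 0, Set.Icc (z.re - r) (z.re + r) ×ℂ Set.Icc (z.im - r) (z.im + r) ⊆ Ω := by
  obtain ⟨ε, hε, h⟩ := Metric.isOpen_iff.1 hΩ z hz
  refine ⟨ε / 3, by positivity, fun w hw => h ?_⟩
  rw [Metric.mem_ball, dist_eq_norm]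
  have h1 : |(w - z).re| ≤ ε / 3 := by
    have := hw.1
    rw [sub_re, abs_le]
    constructor <;> linarith [this.1, this.2]
  have h2 : |(w - z).im| ≤ ε / 3 := by
    have := hw.2
    rw [sub_im, abs_le]
    constructor <;> linarith [this.1, this.2]
  linarith [norm_le_abs_re_add_abs_im (w - z)]

theorem exists_weak_primitive_of_closed_rect_subset {Ω : Set ℂ} {P Q : ℂ → ℝ}
    (hP : MemL2loc Ω P) (hQ : MemL2loc Ω Q)
    (h : ∀ φ, IsTestFun Ω φ → ∫ z, fderiv ℝ φ z I * P z = ∫ z, fderiv ℝ φ z 1 * Q z)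
    {a b c d : ℝ} (hab : a < b) (hΩ : Set.Icc a b ×ℂ Set.Icc c d ⊆ Ω) :
    ∃ v : ℂ → ℝ, MemLp v 2 (volume.restrict (Set.Ioo a b ×ℂ Set.Ioo c d)) ∧
      ∀ φ, IsTestFun (Set.Ioo a b ×ℂ Set.Ioo c d) φ →
        ∫ z, fderiv ℝ φ z 1 * v z = -∫ z, φ z * P z ∧
        ∫ z, fderiv ℝ φ z I * v z = -∫ z, φ z * Q z := by
  have hsub : Set.Ioo a b ×ℂ Set.Ioo c d ⊆ Set.Icc a b ×ℂ Set.Icc c d := fun z hz =>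
    ⟨Set.Ioo_subset_Icc_self hz.1, Set.Ioo_subset_Icc_self hz.2⟩
  set R := Set.Ioo a b ×ℂ Set.Ioo c d with hR
  have hRm : MeasurableSet R := (isOpen_Ioo.reProdIm isOpen_Ioo).measurableSet
  have aux : ∀ f : ℂ → ℝ, MemL2loc Ω f → ∃ g : ℂ → ℝ, Measurable g ∧ MemLp g 2 ∧
      (∀ z, z ∉ R → g z = 0) ∧
      ∀ φ, IsTestFun R φ → ∫ z, φ z * g z = ∫ z, φ z * f z := by
    intro f hf
    have h1 : MemLp f 2 (volume.restrict R) :=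
      (hf _ (isCompact_Icc.reProdIm isCompact_Icc) hΩ).mono_measure
        (Measure.restrict_mono hsub le_rfl)
    refine ⟨R.indicator (h1.1.mk f), h1.1.stronglyMeasurable_mk.measurable.indicator hRm,
      (memLp_indicator_iff_restrict hRm).2 (h1.ae_eq h1.1.ae_eq_mk),
      fun z hz => Set.indicator_of_notMem hz _, fun φ hφ => integral_congr_ae ?_⟩
    filter_upwards [(ae_restrict_iff' hRm).1 h1.1.ae_eq_mk] with z hz
    by_cases hzR : z ∈ R
    · rw [Set.indicator_of_mem hzR, hz hzR]
    · rw [hφ.eq_zero hzR, zero_mul, zero_mul]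
  obtain ⟨P', hPm, hP2, hP0, hPP⟩ := aux P hP
  obtain ⟨Q', hQm, hQ2, hQ0, hQQ⟩ := aux Q hQ
  obtain ⟨v, hv, hvd⟩ := exists_weak_primitive_rect hab hPm hQm hP2 hQ2 hP0 hQ0 fun φ hφ => by
    rw [hPP _ (hφ.fderiv_apply I), hQQ _ (hφ.fderiv_apply 1)]
    exact h φ (hφ.mono (hsub.trans hΩ))
  refine ⟨v, hv, fun φ hφ => ?_⟩
  rw [← hPP φ hφ, ← hQQ φ hφ]
  exact hvd φ hφ

/-- Nonempty open sets have positive measure, so identities between constants can be read off at a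
generic point. -/
theorem of_ae_imp_of_isOpen {U : Set ℂ} (hU : IsOpen U) (hne : U.Nonempty) {p : Prop}
    (h : ∀ᵐ z : ℂ, z ∈ U → p) : p := by
  by_contra hp
  have h0 : volume U = 0 := by
    refine measure_mono_null (fun z hz => ?_) h
    exact fun h' => hp (h' hz)
  exact (hU.measure_pos volume hne).ne' h0

/-- **Weak Poincaré lemma**: on a simply connected domain a locally square integrable weakly
closed field is a weak gradient. -/
theorem exists_hasWeakGrad_of_isSimplyConnected {Ω : Set ℂ} (hΩ : IsOpen Ω)
    (hsc : IsSimplyConnected Ω) {P Q : ℂ → ℝ} (hP : MemL2loc Ω P) (hQ : MemL2loc Ω Q)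
    (h : ∀ φ, IsTestFun Ω φ → ∫ z, fderiv ℝ φ z I * P z = ∫ z, fderiv ℝ φ z 1 * Q z) :
    ∃ v : ℂ → ℝ, HasWeakGrad Ω v P Q := by
  have : SimplyConnectedSpace Ω := hsc
  have : LocallyPathConnectedSpace Ω := hΩ.locallyPathConnectedSpace
  choose r hr0 hr using fun x : Ω => exists_closed_square_subset hΩ x.2
  choose v hvL hvd using fun x : Ω => exists_weak_primitive_of_closed_rect_subset hP hQ h
    (show (x : ℂ).re - r x < (x : ℂ).re + r x by linarith [hr0 x]) (hr x)
  let R : Ω → Set ℂ := fun x => square x (r x)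
  have hRΩ : ∀ x, R x ⊆ Ω := fun x => by
    refine Set.Subset.trans (fun z hz => ?_) (hr x)
    exact ⟨Set.Ioo_subset_Icc_self hz.1, Set.Ioo_subset_Icc_self hz.2⟩
  have hRo : ∀ x, IsOpen (R x) := fun x => isOpen_square _ _
  have hvR : ∀ x, IntegrableOn (v x) (R x) := fun x => by
    have : IsFiniteMeasure (volume.restrict (R x)) :=
      ⟨by simpa [R, square] using volume_rect_lt_top⟩
    exact MemLp.integrable (by norm_num) (hvL x)
  have hc : ∀ x y, ∃ c : ℝ, ∀ᵐ z, z ∈ R x ∩ R y → v x z - v y z = c := by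
    intro x y
    -- Squares are used rather than discs because two of them meet in a rectangle, where
    -- `ae_eq_const_of_weak_grad_eq_zero` applies.
    have e : R x ∩ R y = Set.Ioo (max ((x : ℂ).re - r x) ((y : ℂ).re - r y))
        (min ((x : ℂ).re + r x) ((y : ℂ).re + r y)) ×ℂ
        Set.Ioo (max ((x : ℂ).im - r x) ((y : ℂ).im - r y))
        (min ((x : ℂ).im + r x) ((y : ℂ).im + r y)) := by
      rw [← Set.Ioo_inter_Ioo, ← Set.Ioo_inter_Ioo]
      ext z
      simp only [R, square, mem_reProdIm, Set.mem_inter_iff]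
      tauto
    rw [e]
    have hx := (hvR x).mono_set (Set.inter_subset_left (t := R y))
    have hy := (hvR y).mono_set (Set.inter_subset_right (s := R x))
    refine ae_eq_const_of_weak_grad_eq_zero (v := fun z => v x z - v y z) ?_ fun φ hφ => ?_
    · rw [← e]
      exact hx.sub hy
    · rw [← e] at hφ
      have h1 := hvd x φ (hφ.mono Set.inter_subset_left)
      have h2 := hvd y φ (hφ.mono Set.inter_subset_right)
      have hi : ∀ e, ∫ z, fderiv ℝ φ z e * (v x z - v y z) =
          (∫ z, fderiv ℝ φ z e * v x z) - ∫ z, fderiv ℝ φ z e * v y z := by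
        intro e
        have hφe := hφ.fderiv_apply e
        simp only [mul_sub]
        exact integral_sub
          (hφe.integrable_mul_of_integrableOn (hx.mono_set hφe.support_subset))
          (hφe.integrable_mul_of_integrableOn (hy.mono_set hφe.support_subset))
      rw [hi, hi, h1.1, h1.2, h2.1, h2.2]
      simp
  choose c hc using hc
  obtain ⟨k, hk⟩ : ∃ k : Ω → ℝ, ∀ x y, (R x ∩ R y).Nonempty → k y = k x + c x y := by
    obtain ⟨k, hk⟩ := exists_coboundary (fun x : Ω => ((↑) : Ω → ℂ) ⁻¹' R x)
      (fun x => (hRo x).preimage continuous_subtype_val)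
      (fun x => by
        rw [← Topology.IsInducing.subtypeVal.isPreconnected_image, Subtype.image_preimage_coe,
          Set.inter_eq_right.2 (hRΩ x)]
        exact (((convex_Ioo _ _).linear_preimage reLm).inter
          ((convex_Ioo _ _).linear_preimage imLm)).isPreconnected)
      (fun x => x) (fun x => mem_square_self _ (hr0 x)) c
      (fun x hx => by
        refine of_ae_imp_of_isOpen (hRo x) ⟨_, mem_square_self _ (hr0 x)⟩ ?_
        filter_upwards [hc x x] with z hz hzR
        have := hz ⟨hzR, hzR⟩
        linarith)
      (fun x y w ⟨z₀, hz₀⟩ => by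
        refine of_ae_imp_of_isOpen (((hRo x).inter (hRo y)).inter (hRo w)) ⟨z₀, hz₀⟩ ?_
        filter_upwards [hc x y, hc y w, hc x w] with z h1 h2 h3 hz
        have := h1 hz.1
        have := h2 ⟨hz.1.2, hz.2⟩
        have := h3 ⟨hz.1.1, hz.2⟩
        linarith)
    refine ⟨k, fun x y ⟨z, hz⟩ => hk x y ⟨⟨z, hRΩ x hz.1⟩, hz⟩⟩
  -- Each comparison of local primitives holds off a null set depending on the pair; a countable
  -- subcover keeps the union of these sets null.
  obtain ⟨T, hT, hTU⟩ := TopologicalSpace.isOpen_iUnion_countable R hRo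
  have hcov : Ω ⊆ ⋃ x, R x := fun z hz =>
    Set.mem_iUnion.2 ⟨⟨z, hz⟩, mem_square_self _ (hr0 ⟨z, hz⟩)⟩
  have hpick : ∀ z ∈ Ω, ∃ x ∈ T, z ∈ R x := fun z hz => by
    have := hcov hz
    rw [← hTU] at this
    simpa using this
  classical
  let V : ℂ → ℝ := fun z => if hz : z ∈ Ω then
    v (hpick z hz).choose z + k (hpick z hz).choose else 0
  have hV : ∀ x, ∀ᵐ z, z ∈ R x → V z = v x z + k x := by
    intro x
    have h1 : ∀ᵐ z, ∀ y ∈ T, z ∈ R x ∩ R y → v x z - v y z = c x y :=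
      (ae_ball_iff hT).2 fun y _ => hc x y
    filter_upwards [h1] with z hz hzR
    have hzΩ := hRΩ x hzR
    obtain ⟨hyT, hyR⟩ := (hpick z hzΩ).choose_spec
    have h2 := hz _ hyT ⟨hzR, hyR⟩
    have h3 := hk x _ ⟨z, hzR, hyR⟩
    simp only [V, dif_pos hzΩ]
    linarith
  have hVL : MemL2loc Ω V := by
    refine memL2loc_of_forall_mem_nhds fun z hz => ⟨R ⟨z, hz⟩,
      (hRo _).mem_nhds (mem_square_self _ (hr0 ⟨z, hz⟩)), ?_⟩
    have : IsFiniteMeasure (volume.restrict (R ⟨z, hz⟩)) :=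
      ⟨by simpa [R, square] using volume_rect_lt_top⟩
    have hvz : MemLp (v ⟨z, hz⟩) 2 (volume.restrict (R ⟨z, hz⟩)) := hvL ⟨z, hz⟩
    refine (hvz.add (memLp_const (k ⟨z, hz⟩))).ae_eq ?_
    refine (ae_restrict_iff' (hRo _).measurableSet).2 ?_
    filter_upwards [hV ⟨z, hz⟩] with w hw hwR
    exact (hw hwR).symm
  have hloc : ∀ x φ, IsTestFun (R x) φ → ∫ z, fderiv ℝ φ z 1 * V z = -∫ z, φ z * P z ∧
      ∫ z, fderiv ℝ φ z I * V z = -∫ z, φ z * Q z := by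
    intro x φ hφ
    have hi : ∀ e, ∫ z, fderiv ℝ φ z e * V z = ∫ z, fderiv ℝ φ z e * v x z := by
      intro e
      have hφe := hφ.fderiv_apply e
      have : ∫ z, fderiv ℝ φ z e * V z = ∫ z, fderiv ℝ φ z e * v x z + fderiv ℝ φ z e * k x := by
        refine integral_congr_ae ?_
        filter_upwards [hV x] with z hz
        by_cases hzR : z ∈ R x
        · rw [hz hzR, mul_add]
        · rw [hφe.eq_zero hzR]
          ring
      rw [this, integral_add (hφe.integrable_mul_of_integrableOn
        ((hvR x).mono_set hφe.support_subset)) (hφe.integrable.mul_const _), integral_mul_const,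
        hφ.integral_fderiv, zero_mul, add_zero]
    rw [hi 1, hi I]
    exact hvd x φ hφ
  refine ⟨V, hVL, hP, hQ, fun φ hφ => ?_, fun φ hφ => ?_⟩
  · simp only [smul_eq_mul]
    rw [(hφ.fderiv_apply 1).setIntegral_mul, hφ.setIntegral_mul]
    exact integral_fderiv_mul_eq_of_cover hVL hP 1 R hRo hRΩ hcov (fun x φ hφ => (hloc x φ hφ).1)
      hφ
  · simp only [smul_eq_mul]
    rw [(hφ.fderiv_apply I).setIntegral_mul, hφ.setIntegral_mul]
    exact integral_fderiv_mul_eq_of_cover hVL hQ I R hRo hRΩ hcov (fun x φ hφ => (hloc x φ hφ).2)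
      hφ

/-! ### Carathéodory fields and measurable fixed points -/

/-- Measurability is clear for simple `w`, one value at a time, and passes to limits by continuity
in the second variable. -/
theorem aemeasurable_comp_of_continuous {μ : Measure ℂ} {H : ℂ → ℂ → ℂ}
    (hm : ∀ ζ, AEMeasurable (fun z => H z ζ) μ) (hc : ∀ᵐ z ∂μ, Continuous (H z)) {w : ℂ → ℂ}
    (hw : AEMeasurable w μ) : AEMeasurable (fun z => H z (w z)) μ := by
  have hw' := hw.measurable_mk.stronglyMeasurable
  suffices h : AEMeasurable (fun z => H z (hw.mk w z)) μ by
    refine h.congr ?_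
    filter_upwards [hw.ae_eq_mk] with z hz
    rw [hz]
  refine aemeasurable_of_tendsto_metrizable_ae Filter.atTop
    (f := fun n z => H z (hw'.approx n z)) (fun n => ?_) ?_
  · have : (fun z => H z (hw'.approx n z)) = fun z => ∑ y ∈ (hw'.approx n).range,
        (hw'.approx n ⁻¹' {y}).indicator (fun z => H z y) z := by
      funext z
      rw [Finset.sum_eq_single (hw'.approx n z)]
      · rw [Set.indicator_of_mem (by simp)]
      · intro y _ hy
        exact Set.indicator_of_notMem (fun h => hy h.symm) _
      · intro h
        exact absurd (SimpleFunc.mem_range_self _ z) h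
    rw [this]
    exact Finset.aemeasurable_fun_sum _ fun y _ =>
      (hm y).indicator ((hw'.approx n).measurableSet_fiber y)
  · filter_upwards [hc] with z hz
    exact (hz.tendsto _).comp (hw'.tendsto_approx z)

theorem exists_aemeasurable_fixedPoint {Ω : Set ℂ} (hΩ : MeasurableSet Ω) {k : ℝ} (hk0 : 0 ≤ k)
    (hk1 : k < 1) {T : ℂ → ℂ → ℂ} (hT : IsLipschitzField Ω k T) :
    ∃ p : ℂ → ℂ, AEMeasurable p (volume.restrict Ω) ∧ ∀ z ∈ Ω, T z (p z) = p z := by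
  have hl : ∀ z ∈ Ω, LipschitzWith ⟨k, hk0⟩ (T z) := fun z hz =>
    LipschitzWith.of_dist_le_mul fun x y => by
      rw [dist_eq_norm, dist_eq_norm]
      exact hT.lipschitz z hz x y
  have hcw : ∀ z ∈ Ω, ContractingWith ⟨k, hk0⟩ (T z) := fun z hz => ⟨hk1, hl z hz⟩
  classical
  let p : ℂ → ℂ := fun z => if hz : z ∈ Ω then (hcw z hz).fixedPoint else 0
  refine ⟨p, ?_, fun z hz => ?_⟩
  · have hn : ∀ n : ℕ, AEMeasurable (fun z => (T z)^[n] 0) (volume.restrict Ω) := by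
      intro n
      induction n with
      | zero => exact aemeasurable_const
      | succ n ih =>
        simp only [Function.iterate_succ_apply']
        exact aemeasurable_comp_of_continuous hT.measurable
          ((ae_restrict_iff' hΩ).2 (Filter.Eventually.of_forall fun z hz => (hl z hz).continuous))
          ih
    refine aemeasurable_of_tendsto_metrizable_ae Filter.atTop hn ?_
    refine (ae_restrict_iff' hΩ).2 (Filter.Eventually.of_forall fun z hz => ?_)
    simp only [p, dif_pos hz]
    exact (hcw z hz).tendsto_iterate_fixedPoint 0
  · simp only [p, dif_pos hz]
    exact (hcw z hz).fixedPoint_isFixedPt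

namespace IsLipschitzField

variable {Ω : Set ℂ} {k : ℝ} {H : ℂ → ℂ → ℂ}

theorem aemeasurable_comp (h : IsLipschitzField Ω k H) (hΩ : MeasurableSet Ω) {w : ℂ → ℂ}
    (hw : AEMeasurable w (volume.restrict Ω)) :
    AEMeasurable (fun z => H z (w z)) (volume.restrict Ω) := by
  refine aemeasurable_comp_of_continuous h.measurable ((ae_restrict_iff' hΩ).2
    (Filter.Eventually.of_forall fun z hz => ?_)) hw
  refine (LipschitzWith.of_dist_le' (K := k) fun x y => ?_).continuous
  rw [dist_eq_norm, dist_eq_norm]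
  exact h.lipschitz z hz x y

/-- Translation absorbs an inhomogeneous term into the field while keeping the value `0` at `0`. -/
theorem translate (h : IsLipschitzField Ω k H) (hΩ : MeasurableSet Ω) {w : ℂ → ℂ}
    (hw : AEMeasurable w (volume.restrict Ω)) :
    IsLipschitzField Ω k fun z ζ => H z (ζ + w z) - H z (w z) where
  measurable ζ := (h.aemeasurable_comp hΩ (hw.const_add ζ)).sub (h.aemeasurable_comp hΩ hw)
  lipschitz z hz ζ η := by
    have := h.lipschitz z hz (ζ + w z) (η + w z)
    simpa using this

theorem memL2loc_comp (h : IsLipschitzField Ω k H) (hΩ : IsOpen Ω) (h0 : ∀ z ∈ Ω, H z 0 = 0)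
    {w : ℂ → ℂ} (hw : MemL2loc Ω w) : MemL2loc Ω fun z => H z (w z) := by
  intro C hC hCΩ
  have hm : AEStronglyMeasurable (fun z => H z (w z)) (volume.restrict Ω) :=
    (h.aemeasurable_comp hΩ.measurableSet
      (hw.aestronglyMeasurable hΩ).aemeasurable).aestronglyMeasurable
  refine (hw C hC hCΩ).of_le_mul (c := k) (hm.mono_measure (Measure.restrict_mono hCΩ le_rfl))
    ((ae_restrict_iff' hC.measurableSet).2 (Filter.Eventually.of_forall fun z hz => ?_))
  have := h.lipschitz z (hCΩ hz) (w z) 0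
  simpa [h0 z (hCΩ hz)] using this

end IsLipschitzField

/-! ### Ellipticity and the Cayley transform -/

/-- The polarisation identities relating sums and differences. -/
theorem norm_add_sq_sub (x y : ℂ) : ‖x + y‖ ^ 2 + ‖x - y‖ ^ 2 = 2 * (‖x‖ ^ 2 + ‖y‖ ^ 2) ∧
    inner ℝ (x + y) (x - y) = ‖x‖ ^ 2 - ‖y‖ ^ 2 := by
  have h1 := norm_add_sq_real x y
  have h2 := norm_sub_sq_real x y
  refine ⟨by linarith, ?_⟩
  rw [inner_add_left, inner_sub_right, inner_sub_right, real_inner_self_eq_norm_sq,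
    real_inner_self_eq_norm_sq, real_inner_comm x y]
  ring

namespace IsStronglyElliptic

variable {Ω : Set ℂ} {K : ℝ} {A : ℂ → ℂ → ℂ}

theorem isLipschitzField (h : IsStronglyElliptic Ω K A) (hK : 1 ≤ K) :
    IsLipschitzField Ω (K + 1 / K) A where
  measurable := h.measurable
  lipschitz z hz ζ η := by
    have h1 := h.elliptic z hz ζ η
    have h2 := real_inner_le_norm (ζ - η) (A z ζ - A z η)
    have hK0 : 0 ≤ K + 1 / K := by positivity
    rcases eq_or_lt_of_le (norm_nonneg (A z ζ - A z η)) with h3 | h3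
    · rw [← h3]
      positivity
    · have h4 := mul_le_mul_of_nonneg_left h2 hK0
      nlinarith [sq_nonneg ‖ζ - η‖]

theorem translate (h : IsStronglyElliptic Ω K A) (hK : 1 ≤ K) (hΩ : MeasurableSet Ω) {w : ℂ → ℂ}
    (hw : AEMeasurable w (volume.restrict Ω)) :
    IsStronglyElliptic Ω K fun z ξ => A z (ξ + w z) - A z (w z) where
  measurable := ((h.isLipschitzField hK).translate hΩ hw).measurable
  elliptic z hz ξ₁ ξ₂ := by
    have := h.elliptic z hz (ξ₁ + w z) (ξ₂ + w z)
    simpa using this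
  map_zero z hz := by simp

/-- Strong ellipticity says that `A - ½ (K + 1/K) id` is a small Lipschitz perturbation. -/
theorem lipschitz_sub (h : IsStronglyElliptic Ω K A) (hK : 1 ≤ K) {z : ℂ} (hz : z ∈ Ω)
    (ξ₁ ξ₂ : ℂ) : ‖(A z ξ₁ - A z ξ₂) - ((K + 1 / K) / 2) • (ξ₁ - ξ₂)‖ ≤
      (K - 1 / K) / 2 * ‖ξ₁ - ξ₂‖ := by
  have h1 := h.elliptic z hz ξ₁ ξ₂
  have hK1 : 1 / K ≤ K := ((div_le_one (by linarith)).2 hK).trans hK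
  refine le_of_sq_le_sq ?_ (mul_nonneg (by linarith) (norm_nonneg _))
  rw [norm_sub_sq_real, inner_smul_right, norm_smul, real_inner_comm, mul_pow, mul_pow,
    Real.norm_eq_abs, sq_abs]
  -- This identity makes the bound exactly the ellipticity inequality with the square completed.
  have h2 : ((K + 1 / K) / 2) ^ 2 = ((K - 1 / K) / 2) ^ 2 + 1 := by
    field_simp
    ring
  rw [h2]
  linarith

end IsStronglyElliptic

/-- The Cayley transform of a Lipschitz field is strongly elliptic. -/
theorem IsLipschitzField.exists_isStronglyElliptic {Ω : Set ℂ} (hΩ : MeasurableSet Ω) {k : ℝ}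
    (hk0 : 0 ≤ k) (hk1 : k < 1) {H : ℂ → ℂ → ℂ} (h : IsLipschitzField Ω k H)
    (h0 : ∀ z ∈ Ω, H z 0 = 0) :
    ∃ A : ℂ → ℂ → ℂ, IsStronglyElliptic Ω ((1 + k) / (1 - k)) A ∧
      ∀ z ∈ Ω, ∀ p, A z (conj p + H z p) = conj p - H z p := by
  -- The equation `conj p + H(p) = ξ` is rewritten as the fixed point problem `p = conj (ξ - H(p))`,
  -- a contraction with constant `k`.
  have hT : ∀ ξ : ℂ, IsLipschitzField Ω k fun z p => conj (ξ - H z p) := fun ξ =>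
    { measurable := fun ζ => continuous_conj.measurable.comp_aemeasurable
        ((h.measurable ζ).const_sub ξ)
      lipschitz := fun z hz ζ η => by
        rw [← map_sub, RCLike.norm_conj, sub_sub_sub_cancel_left, norm_sub_rev]
        exact h.lipschitz z hz ζ η }
  choose p hpm hp using fun ξ => exists_aemeasurable_fixedPoint hΩ hk0 hk1 (hT ξ)
  have hp' : ∀ ξ, ∀ z ∈ Ω, conj (p ξ z) + H z (p ξ z) = ξ := fun ξ z hz => by
    have := congrArg conj (hp ξ z hz)
    rw [conj_conj] at this
    rw [← this]
    ring
  have huniq : ∀ z ∈ Ω, ∀ p₁ p₂ : ℂ, conj p₁ + H z p₁ = conj p₂ + H z p₂ → p₁ = p₂ := by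
    intro z hz p₁ p₂ he
    have h1 := h.lipschitz z hz p₁ p₂
    have h2 : H z p₁ - H z p₂ = -conj (p₁ - p₂) := by
      rw [map_sub]
      linear_combination he
    rw [h2, norm_neg, RCLike.norm_conj] at h1
    have h3 : ‖p₁ - p₂‖ = 0 := by nlinarith [norm_nonneg (p₁ - p₂)]
    exact sub_eq_zero.1 (norm_eq_zero.1 h3)
  refine ⟨fun z ξ => conj (p ξ z) - H z (p ξ z), ⟨fun ξ => ?_, fun z hz ξ₁ ξ₂ => ?_,
    fun z hz => ?_⟩, fun z hz q => ?_⟩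
  · exact (continuous_conj.measurable.comp_aemeasurable (hpm ξ)).sub
      (h.aemeasurable_comp hΩ (hpm ξ))
  · have e1 := hp' ξ₁ z hz
    have e2 := hp' ξ₂ z hz
    have hl := h.lipschitz z hz (p ξ₁ z) (p ξ₂ z)
    generalize p ξ₁ z = p₁ at *
    generalize p ξ₂ z = p₂ at *
    subst e1 e2
    have s1 : conj p₁ + H z p₁ - (conj p₂ + H z p₂) =
        conj (p₁ - p₂) + (H z p₁ - H z p₂) := by
      rw [map_sub]
      ring
    have s2 : conj p₁ - H z p₁ - (conj p₂ - H z p₂) =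
        conj (p₁ - p₂) - (H z p₁ - H z p₂) := by
      rw [map_sub]
      ring
    obtain ⟨i1, i2⟩ := norm_add_sq_sub (conj (p₁ - p₂)) (H z p₁ - H z p₂)
    rw [s1, s2, i1, i2, RCLike.norm_conj]
    have hsq : ‖H z p₁ - H z p₂‖ ^ 2 ≤ k ^ 2 * ‖p₁ - p₂‖ ^ 2 := by
      rw [← mul_pow]
      gcongr
    have hk2 : 0 < 1 - k := by linarith
    have hk3 : 0 < 1 + k := by linarith
    have hc : (1 + k) / (1 - k) + 1 / ((1 + k) / (1 - k)) = 2 * (1 + k ^ 2) / (1 - k ^ 2) := by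
      have : 1 - k ^ 2 = (1 - k) * (1 + k) := by ring
      rw [this]
      field_simp
      ring
    have hk4 : 0 < 1 - k ^ 2 := by nlinarith
    rw [hc, div_mul_eq_mul_div, le_div_iff₀ hk4]
    nlinarith
  · have : p 0 z = 0 := huniq z hz _ _ (by rw [hp' 0 z hz, h0 z hz]; simp)
    simp [this, h0 z hz]
  · have : p (conj q + H z q) z = q := huniq z hz _ _ (hp' _ z hz)
    simp only [this]

/-- The inverse Cayley transform of a strongly elliptic field is Lipschitz. -/
theorem IsStronglyElliptic.exists_isLipschitzField {Ω : Set ℂ} (hΩ : MeasurableSet Ω) {K : ℝ}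
    (hK : 1 ≤ K) {A : ℂ → ℂ → ℂ} (h : IsStronglyElliptic Ω K A) :
    ∃ H : ℂ → ℂ → ℂ, IsLipschitzField Ω ((K - 1) / (K + 1)) H ∧
      ∀ z ∈ Ω, ∀ ξ, H z (conj ((ξ + A z ξ) / 2)) = (ξ - A z ξ) / 2 := by
  set κ : ℝ := (K + 1 / K) / 2 with hκ
  set k : ℝ := (K - 1) / (K + 1) with hk
  have hK0 : 0 < K := by linarith
  have hk0 : 0 ≤ k := div_nonneg (by linarith) (by linarith)
  have hk1 : k < 1 := (div_lt_one (by linarith)).2 (by linarith)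
  have hκ0 : 0 < 1 + κ := by positivity
  -- Writing `A = κ id + (A - κ id)` turns `ξ + A(ξ) = 2 conj p` into a fixed point problem whose
  -- contraction constant is `((K - 1/K)/2)/(1 + κ)`, which is `k`.
  have hkκ : (K - 1 / K) / 2 = k * (1 + κ) := by
    rw [hk, hκ]
    field_simp
    ring
  have hT : ∀ p : ℂ, IsLipschitzField Ω k
      fun z ξ => (1 + κ)⁻¹ • (2 * conj p - (A z ξ - κ • ξ)) := fun p =>
    { measurable := fun ξ => (((h.measurable ξ).sub_const _).const_sub _).const_smul (1 + κ)⁻¹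
      lipschitz := fun z hz ξ₁ ξ₂ => by
        have h1 := h.lipschitz_sub hK hz ξ₁ ξ₂
        rw [hkκ, ← hκ] at h1
        rw [← smul_sub, sub_sub_sub_cancel_left, norm_smul, Real.norm_of_nonneg
          (inv_nonneg.2 hκ0.le), inv_mul_le_iff₀ hκ0, norm_sub_rev]
        have : A z ξ₁ - κ • ξ₁ - (A z ξ₂ - κ • ξ₂) = A z ξ₁ - A z ξ₂ - κ • (ξ₁ - ξ₂) := by
          rw [smul_sub]
          ring
        rw [this]
        linarith }
  choose X hXm hX using fun p => exists_aemeasurable_fixedPoint hΩ hk0 hk1 (hT p)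
  have hX' : ∀ p, ∀ z ∈ Ω, X p z + A z (X p z) = 2 * conj p := fun p z hz => by
    have h1 := hX p z hz
    rw [inv_smul_eq_iff₀ hκ0.ne', add_smul, one_smul] at h1
    linear_combination -h1
  have hlip : ∀ z ∈ Ω, ∀ ξ₁ ξ₂ : ℂ, ‖(ξ₁ - A z ξ₁) - (ξ₂ - A z ξ₂)‖ ≤
      k * ‖(ξ₁ + A z ξ₁) - (ξ₂ + A z ξ₂)‖ := by
    intro z hz ξ₁ ξ₂
    have h1 := h.elliptic z hz ξ₁ ξ₂
    refine le_of_sq_le_sq ?_ (mul_nonneg hk0 (norm_nonneg _))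
    have s1 : (ξ₁ - A z ξ₁) - (ξ₂ - A z ξ₂) = (ξ₁ - ξ₂) - (A z ξ₁ - A z ξ₂) := by ring
    have s2 : (ξ₁ + A z ξ₁) - (ξ₂ + A z ξ₂) = (ξ₁ - ξ₂) + (A z ξ₁ - A z ξ₂) := by ring
    rw [s1, s2, mul_pow, norm_add_sq_real, norm_sub_sq_real]
    generalize inner ℝ (ξ₁ - ξ₂) (A z ξ₁ - A z ξ₂) = i at *
    generalize ‖ξ₁ - ξ₂‖ ^ 2 = x at *
    generalize ‖A z ξ₁ - A z ξ₂‖ ^ 2 = y at *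
    -- Cleared of denominators, the claim reads `K(x + y) ≤ (K² + 1) i`, which is ellipticity
    -- multiplied by `K`.
    rw [hk, div_pow, div_mul_eq_mul_div, le_div_iff₀ (by positivity)]
    have h2 := mul_le_mul_of_nonneg_left h1 hK0.le
    have h3 : K * ((K + 1 / K) * i) = (K ^ 2 + 1) * i := by
      field_simp
    rw [h3] at h2
    nlinarith
  refine ⟨fun z p => (X p z - A z (X p z)) / 2, ⟨fun p => ?_, fun z hz p₁ p₂ => ?_⟩,
    fun z hz ξ => ?_⟩
  · exact ((hXm p).sub ((h.isLipschitzField hK).aemeasurable_comp hΩ (hXm p))).div_const 2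
  · have h1 := hlip z hz (X p₁ z) (X p₂ z)
    rw [hX' _ z hz, hX' _ z hz, ← mul_sub, ← map_sub, norm_mul, RCLike.norm_conj] at h1
    rw [← sub_div, norm_div]
    simp only [RCLike.norm_ofNat] at h1 ⊢
    linarith
  · have h1 := hlip z hz (X (conj ((ξ + A z ξ) / 2)) z) ξ
    rw [hX' _ z hz, conj_conj, mul_div_cancel₀ _ two_ne_zero, sub_self, norm_zero,
      mul_zero] at h1
    have h2 := sub_eq_zero.1 (norm_le_zero_iff.1 h1)
    simp only [h2]

/-! ### Operations on `L²_loc` functions and weak gradients -/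

namespace MemL2loc

variable {E F : Type*} [NormedAddCommGroup E] [NormedAddCommGroup F] {Ω : Set ℂ}

theorem add {f g : ℂ → F} (hf : MemL2loc Ω f) (hg : MemL2loc Ω g) :
    MemL2loc Ω fun z => f z + g z := fun C hC hCΩ => (hf C hC hCΩ).add (hg C hC hCΩ)

theorem sub {f g : ℂ → F} (hf : MemL2loc Ω f) (hg : MemL2loc Ω g) :
    MemL2loc Ω fun z => f z - g z := fun C hC hCΩ => (hf C hC hCΩ).sub (hg C hC hCΩ)

theorem clm_comp [NormedSpace ℝ E] [NormedSpace ℝ F] (L : E →L[ℝ] F) {f : ℂ → E}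
    (hf : MemL2loc Ω f) : MemL2loc Ω fun z => L (f z) := fun C hC hCΩ =>
  L.comp_memLp' (hf C hC hCΩ)

theorem const_mul (c : ℂ) {f : ℂ → ℂ} (hf : MemL2loc Ω f) : MemL2loc Ω fun z => c * f z :=
  fun C hC hCΩ => (hf C hC hCΩ).const_mul c

theorem congr_ae {f g : ℂ → F} (hf : MemL2loc Ω f) (h : ∀ᵐ z ∂(volume.restrict Ω), f z = g z) :
    MemL2loc Ω g := fun C hC hCΩ =>
  (hf C hC hCΩ).ae_eq (ae_restrict_of_ae_restrict_of_subset hCΩ h)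

end MemL2loc

theorem IsTestFun.integrableOn_smul {F : Type*} [NormedAddCommGroup F] [NormedSpace ℝ F]
    {Ω : Set ℂ} {φ : ℂ → ℝ} (h : IsTestFun Ω φ) {f : ℂ → F} (hf : MemL2loc Ω f) :
    IntegrableOn (fun z => φ z • f z) Ω := by
  obtain ⟨C, hC⟩ := h.exists_bound
  refine Integrable.integrableOn
    ((integrableOn_iff_integrable_of_support_subset (s := tsupport φ) fun z hz => ?_).1
    ((hf.integrableOn h.compactSupport.isCompact h.support_subset).bdd_smul C
      h.continuous.aestronglyMeasurable (Filter.Eventually.of_forall hC)))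
  exact subset_tsupport _ (left_ne_zero_of_smul hz)

namespace HasWeakGrad

variable {E F : Type*} [NormedAddCommGroup E] [NormedSpace ℝ E]
  [NormedAddCommGroup F] [NormedSpace ℝ F] {Ω : Set ℂ}

theorem clm_comp [CompleteSpace E] [CompleteSpace F] (L : E →L[ℝ] F) {f fx fy : ℂ → E}
    (h : HasWeakGrad Ω f fx fy) :
    HasWeakGrad Ω (fun z => L (f z)) (fun z => L (fx z)) (fun z => L (fy z)) where
  memL2loc := h.memL2loc.clm_comp L
  memL2loc_x := h.memL2loc_x.clm_comp L
  memL2loc_y := h.memL2loc_y.clm_comp L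
  weak_x φ hφ := by
    simp only [← map_smul]
    rw [L.integral_comp_comm ((hφ.fderiv_apply 1).integrableOn_smul h.memL2loc),
      L.integral_comp_comm (hφ.integrableOn_smul h.memL2loc_x), h.weak_x φ hφ, map_neg]
  weak_y φ hφ := by
    simp only [← map_smul]
    rw [L.integral_comp_comm ((hφ.fderiv_apply I).integrableOn_smul h.memL2loc),
      L.integral_comp_comm (hφ.integrableOn_smul h.memL2loc_y), h.weak_y φ hφ, map_neg]

theorem add {f fx fy g gx gy : ℂ → F} (hf : HasWeakGrad Ω f fx fy) (hg : HasWeakGrad Ω g gx gy) :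
    HasWeakGrad Ω (fun z => f z + g z) (fun z => fx z + gx z) (fun z => fy z + gy z) where
  memL2loc := hf.memL2loc.add hg.memL2loc
  memL2loc_x := hf.memL2loc_x.add hg.memL2loc_x
  memL2loc_y := hf.memL2loc_y.add hg.memL2loc_y
  weak_x φ hφ := by
    simp only [smul_add]
    rw [integral_add ((hφ.fderiv_apply 1).integrableOn_smul hf.memL2loc)
      ((hφ.fderiv_apply 1).integrableOn_smul hg.memL2loc), integral_add
      (hφ.integrableOn_smul hf.memL2loc_x) (hφ.integrableOn_smul hg.memL2loc_x),
      hf.weak_x φ hφ, hg.weak_x φ hφ, neg_add]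
  weak_y φ hφ := by
    simp only [smul_add]
    rw [integral_add ((hφ.fderiv_apply I).integrableOn_smul hf.memL2loc)
      ((hφ.fderiv_apply I).integrableOn_smul hg.memL2loc), integral_add
      (hφ.integrableOn_smul hf.memL2loc_y) (hφ.integrableOn_smul hg.memL2loc_y),
      hf.weak_y φ hφ, hg.weak_y φ hφ, neg_add]

/-- Weak gradients are weakly closed. -/
theorem integral_fderiv_mul_comm {v vx vy : ℂ → ℝ} (h : HasWeakGrad Ω v vx vy) {φ : ℂ → ℝ}
    (hφ : IsTestFun Ω φ) :
    ∫ z in Ω, fderiv ℝ φ z I * vx z = ∫ z in Ω, fderiv ℝ φ z 1 * vy z := by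
  have h1 := h.weak_x _ (hφ.fderiv_apply I)
  have h2 := h.weak_y _ (hφ.fderiv_apply 1)
  -- Both sides equal minus the integral of `v` against the mixed second derivative of `φ`, which is
  -- symmetric.
  have hs : ∀ z, fderiv ℝ (fun z => fderiv ℝ φ z I) z 1 =
      fderiv ℝ (fun z => fderiv ℝ φ z 1) z I := by
    intro z
    have hd : DifferentiableAt ℝ (fderiv ℝ φ) z :=
      (hφ.smooth.fderiv_right (m := ((⊤ : ℕ∞) : WithTop ℕ∞)) (by simp)).differentiable
        (by simp) z
    have hsym : IsSymmSndFDerivAt ℝ φ z := by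
      refine ((hφ.smooth.of_le (m := 2) ?_).contDiffAt).isSymmSndFDerivAt (by simp)
      exact WithTop.coe_le_coe.2 le_top
    rw [fderiv_clm_apply hd (by fun_prop), fderiv_clm_apply hd (by fun_prop)]
    simpa using hsym.eq 1 I
  simp only [hs] at h1
  rw [h1] at h2
  simpa using neg_injective h2

end HasWeakGrad

/-! ### Passage between the two equations -/

theorem conj_div_two (z : ℂ) : conj (z / 2) = conj z / 2 := by
  rw [map_div₀, conj_ofNat]

theorem fderiv_apply_eq_re_im (φ : ℂ → ℝ) (z w : ℂ) :
    fderiv ℝ φ z w = fderiv ℝ φ z 1 * w.re + fderiv ℝ φ z I * w.im := by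
  have : w = w.re • (1 : ℂ) + w.im • I := by
    apply Complex.ext <;> simp
  conv_lhs => rw [this, map_add, map_smul, map_smul]
  simp [mul_comm]

theorem IsTestFun.integral_fderiv_apply {Ω : Set ℂ} {φ : ℂ → ℝ} (hφ : IsTestFun Ω φ) {V : ℂ → ℂ}
    (hV : MemL2loc Ω V) : ∫ z in Ω, fderiv ℝ φ z (V z) =
      (∫ z in Ω, fderiv ℝ φ z 1 * (V z).re) + ∫ z in Ω, fderiv ℝ φ z I * (V z).im := by
  simp only [fderiv_apply_eq_re_im φ _ (V _)]
  exact integral_add ((hφ.fderiv_apply 1).integrableOn_smul (hV.clm_comp reCLM))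
    ((hφ.fderiv_apply I).integrableOn_smul (hV.clm_comp imCLM))

/-- The real part of a solution of an inhomogeneous Beltrami equation solves a Leray-Lions
equation. -/
theorem IsLipschitzField.exists_lerayLions {Ω : Set ℂ} (hΩ : IsOpen Ω) {k : ℝ} (hk0 : 0 ≤ k)
    (hk1 : k < 1) {H : ℂ → ℂ → ℂ} (G : ℂ → ℂ) (hH : IsLipschitzField Ω k H) :
    ∃ (A : ℂ → ℂ → ℂ) (g : ℂ → ℂ),
      IsStronglyElliptic Ω ((1 + k) / (1 - k)) A ∧ MemL2loc Ω g ∧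
      ∀ f : ℂ → ℂ, SolvesBeltrami Ω H G f →
        SolvesLerayLions Ω A g (fun z => (f z).re) := by
  have hΩm := hΩ.measurableSet
  have hK : 1 ≤ (1 + k) / (1 - k) := (one_le_div (by linarith)).2 (by linarith)
  have hH0 : IsLipschitzField Ω k fun z ζ => H z ζ - H z 0 := by
    simpa using hH.translate hΩm (w := fun _ => 0) aemeasurable_const
  obtain ⟨A, hA, hAH⟩ := hH0.exists_isStronglyElliptic hΩm hk0 hk1 fun z _ => sub_self _
  -- Nothing is assumed about `G`. Without solutions there is nothing to prove; a single solution
  -- forces `G + H(·, 0)` to be in `L²_loc`, being almost everywhere `f_z̄` minus the normalised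
  -- field at `f_z`.
  by_cases hex : ∃ f, SolvesBeltrami Ω H G f
  swap
  · exact ⟨A, fun _ => 0, hA, fun C _ _ => by simp, fun f hf => absurd ⟨f, hf⟩ hex⟩
  have hz : ∀ {f fx fy : ℂ → ℂ}, HasWeakGrad Ω f fx fy →
      MemL2loc Ω (fun z => (fx z - I * fy z) / 2) ∧
      MemL2loc Ω (fun z => (fx z + I * fy z) / 2) := by
    intro f fx fy hf
    have h1 := (hf.memL2loc_x.sub (hf.memL2loc_y.const_mul I)).const_mul (1 / 2)
    have h2 := (hf.memL2loc_x.add (hf.memL2loc_y.const_mul I)).const_mul (1 / 2)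
    simp only [one_div, inv_mul_eq_div] at h1 h2
    exact ⟨h1, h2⟩
  have hG : MemL2loc Ω fun z => G z + H z 0 := by
    obtain ⟨f, fx, fy, hf, hfe⟩ := hex
    obtain ⟨h1, h2⟩ := hz hf
    refine (h2.sub (hH0.memL2loc_comp hΩ (fun z _ => sub_self _) h1)).congr_ae ?_
    filter_upwards [hfe] with z hz
    rw [hz]
    ring
  set G₀ : ℂ → ℂ := fun z => G z + H z 0 with hG₀
  have hGn : MemL2loc Ω fun z => -G₀ z := by simpa using hG.const_mul (-1)
  have hGm := (hGn.aestronglyMeasurable hΩ).aemeasurable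
  have hAG := (hA.isLipschitzField hK).memL2loc_comp hΩ hA.map_zero hGn
  have hA' := hA.translate hK hΩm hGm
  -- Here `conj f_z + H₀(f_z) = ∇u - G₀`, with `H₀ = H - H(·, 0)`, so `A(∇u - G₀) = (v_y - i v_x) +
  -- G₀`. Subtracting `A(-G₀)` from both sides normalises the field and determines `g`.
  refine ⟨_, fun z => G₀ z - A z (-G₀ z), hA', hG.sub hAG, ?_⟩
  rintro f ⟨fx, fy, hf, hfe⟩
  have hre := hf.clm_comp reCLM
  have him := hf.clm_comp imCLM
  refine ⟨_, _, hre, ?_⟩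
  have hgrad : MemL2loc Ω fun z => ((reCLM (fx z) : ℝ) : ℂ) + I * ((reCLM (fy z) : ℝ) : ℂ) :=
    (hre.memL2loc_x.clm_comp ofRealCLM).add ((hre.memL2loc_y.clm_comp ofRealCLM).const_mul I)
  have hAL := (hA'.isLipschitzField hK).memL2loc_comp hΩ hA'.map_zero hgrad
  refine ⟨hAL.locallyIntegrableOn hΩ, (hG.sub hAG).locallyIntegrableOn hΩ, fun φ hφ => ?_⟩
  have hae : ∀ᵐ z ∂(volume.restrict Ω),
      A z (((reCLM (fx z) : ℝ) : ℂ) + I * ((reCLM (fy z) : ℝ) : ℂ) + -G₀ z) - A z (-G₀ z) =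
        (G₀ z - A z (-G₀ z)) + (((imCLM (fy z) : ℝ) : ℂ) + -I * ((imCLM (fx z) : ℝ) : ℂ)) := by
    filter_upwards [hfe, ae_restrict_mem hΩm] with z hz hzΩ
    have h1 := hAH z hzΩ ((fx z - I * fy z) / 2)
    have e1 : conj ((fx z - I * fy z) / 2) + (fx z + I * fy z) / 2 =
        ((reCLM (fx z) : ℝ) : ℂ) + I * ((reCLM (fy z) : ℝ) : ℂ) := by
      rw [conj_div_two]
      apply Complex.ext <;> simp <;> ring
    have e2 : conj ((fx z - I * fy z) / 2) - (fx z + I * fy z) / 2 =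
        ((imCLM (fy z) : ℝ) : ℂ) + -I * ((imCLM (fx z) : ℝ) : ℂ) := by
      rw [conj_div_two]
      apply Complex.ext <;> simp <;> ring
    have e3 : conj ((fx z - I * fy z) / 2) +
        (H z ((fx z - I * fy z) / 2) - H z 0) =
        ((reCLM (fx z) : ℝ) : ℂ) + I * ((reCLM (fy z) : ℝ) : ℂ) + -G₀ z := by
      rw [← e1, hz, hG₀]
      ring
    rw [← e3, h1, ← e2, hz, hG₀]
    ring
  have hrot : MemL2loc Ω fun z => ((imCLM (fy z) : ℝ) : ℂ) + -I * ((imCLM (fx z) : ℝ) : ℂ) :=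
    (him.memL2loc_y.clm_comp ofRealCLM).add
      ((him.memL2loc_x.clm_comp ofRealCLM).const_mul (-I))
  have hcongr : ∫ z in Ω, fderiv ℝ φ z
      (A z (((reCLM (fx z) : ℝ) : ℂ) + I * ((reCLM (fy z) : ℝ) : ℂ) + -G₀ z) - A z (-G₀ z)) =
      ∫ z in Ω, fderiv ℝ φ z ((G₀ z - A z (-G₀ z)) +
        (((imCLM (fy z) : ℝ) : ℂ) + -I * ((imCLM (fx z) : ℝ) : ℂ))) := by
    refine integral_congr_ae ?_
    filter_upwards [hae] with z hz
    rw [hz]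
  refine hcongr.trans ?_
  rw [hφ.integral_fderiv_apply ((hG.sub hAG).add hrot), hφ.integral_fderiv_apply (hG.sub hAG)]
  have hcomm := him.integral_fderiv_mul_comm hφ
  have hsplit : ∀ (e : ℂ) (a b : ℂ → ℝ), MemL2loc Ω a → MemL2loc Ω b →
      ∫ z in Ω, fderiv ℝ φ z e * (a z + b z) =
        (∫ z in Ω, fderiv ℝ φ z e * a z) + ∫ z in Ω, fderiv ℝ φ z e * b z := by
    intro e a b ha hb
    simp only [mul_add]
    exact integral_add ((hφ.fderiv_apply e).integrableOn_smul ha)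
      ((hφ.fderiv_apply e).integrableOn_smul hb)
  simp only [add_re, add_im]
  have hg := hG.sub hAG
  have r1 := hsplit 1 _ _ (hg.clm_comp reCLM) (hrot.clm_comp reCLM)
  have r2 := hsplit I _ _ (hg.clm_comp imCLM) (hrot.clm_comp imCLM)
  simp only [reCLM_apply, imCLM_apply] at r1 r2 hcomm
  simp only [add_re, add_im] at r1 r2
  simp only [imCLM_apply]
  rw [r1, r2]
  simp only [mul_re, mul_im, neg_re, neg_im, I_re, I_im, ofReal_re, ofReal_im]
  ring_nf
  ring_nf at hcomm
  rw [integral_neg, hcomm]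
  ring

/-- On a simply connected domain a solution of a Leray-Lions equation is the real part of a
solution of an inhomogeneous Beltrami equation. -/
theorem IsStronglyElliptic.exists_beltrami {Ω : Set ℂ} (hΩ : IsOpen Ω) (hsc : IsSimplyConnected Ω)
    {K : ℝ} (hK : 1 ≤ K) {A : ℂ → ℂ → ℂ} {g : ℂ → ℂ} (hA : IsStronglyElliptic Ω K A)
    (hg : MemL2loc Ω g) :
    ∃ (H : ℂ → ℂ → ℂ) (G : ℂ → ℂ),
      IsLipschitzField Ω ((K - 1) / (K + 1)) H ∧ (∀ z ∈ Ω, H z 0 = 0) ∧ MemL2loc Ω G ∧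
      ∀ u : ℂ → ℝ, SolvesLerayLions Ω A g u →
        ∃ v : ℂ → ℝ, MemW12loc Ω v ∧
          SolvesBeltrami Ω H G (fun z => (u z : ℂ) + I * (v z : ℂ)) := by
  have hΩm := hΩ.measurableSet
  obtain ⟨H, hH, hHA⟩ := hA.exists_isLipschitzField hΩm hK
  have hH0 : ∀ z ∈ Ω, H z 0 = 0 := fun z hz => by
    simpa [hA.map_zero z hz] using hHA z hz 0
  have hg2 : MemL2loc Ω fun z => 1 / 2 * conj (g z) :=
    (hg.clm_comp (conjCLE : ℂ →L[ℝ] ℂ)).const_mul (1 / 2)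
  have hHg := hH.memL2loc_comp hΩ hH0 hg2
  -- With `A(∇u) - g = v_y - i v_x`, one has `(∇u + A(∇u))/2 = conj f_z + g/2` and `(∇u - A(∇u))/2 =
  -- f_z̄ - g/2`. Hence `f_z̄ = g/2 + H(f_z + conj g/2)`, and splitting off the value at `f_z = 0`
  -- gives `G`.
  refine ⟨_, fun z => 1 / 2 * g z + H z (1 / 2 * conj (g z)),
    hH.translate hΩm (hg2.aestronglyMeasurable hΩ).aemeasurable, fun z _ => by simp,
    (hg.const_mul _).add hHg, ?_⟩
  rintro u ⟨ux, uy, hu, hdiv⟩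
  have hgrad : MemL2loc Ω fun z => (ux z : ℂ) + I * (uy z : ℂ) :=
    (hu.memL2loc_x.clm_comp ofRealCLM).add ((hu.memL2loc_y.clm_comp ofRealCLM).const_mul I)
  have hAL := (hA.isLipschitzField hK).memL2loc_comp hΩ hA.map_zero hgrad
  set a : ℂ → ℂ := fun z => A z ((ux z : ℂ) + I * (uy z : ℂ)) - g z with ha
  have haL : MemL2loc Ω a := hAL.sub hg
  -- The stream function must satisfy `v_y - i v_x = a`, so its gradient is `(-Im a, Re a)`; this
  -- field is weakly closed because `a` is divergence free.
  have hP : MemL2loc Ω fun z => -(a z).im := haL.clm_comp (-imCLM)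
  have hQ : MemL2loc Ω fun z => (a z).re := haL.clm_comp reCLM
  obtain ⟨v, hv⟩ := exists_hasWeakGrad_of_isSimplyConnected hΩ hsc hP hQ fun φ hφ => by
    have h1 := hdiv.weak φ hφ
    have h2 := hφ.integral_fderiv_apply haL
    have h3 : ∫ z in Ω, fderiv ℝ φ z (a z) = 0 := by
      have i1 : ∀ {V : ℂ → ℂ}, MemL2loc Ω V →
          IntegrableOn (fun z => fderiv ℝ φ z (V z)) Ω := by
        intro V hV
        simp only [fderiv_apply_eq_re_im φ _ (V _)]
        exact ((hφ.fderiv_apply 1).integrableOn_smul (hV.clm_comp reCLM)).add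
          ((hφ.fderiv_apply I).integrableOn_smul (hV.clm_comp imCLM))
      simp only [ha, map_sub]
      rw [integral_sub (i1 hAL) (i1 hg), h1, sub_self]
    rw [h3, (hφ.fderiv_apply 1).setIntegral_mul, (hφ.fderiv_apply I).setIntegral_mul] at h2
    simp only [mul_neg, integral_neg]
    linarith
  have hf := (hu.clm_comp ofRealCLM).add (hv.clm_comp (I • ofRealCLM))
  refine ⟨v, ⟨_, _, hv⟩, _, _, hf, ?_⟩
  filter_upwards [ae_restrict_mem hΩm] with z hz
  have h1 := hHA z hz ((ux z : ℂ) + I * (uy z : ℂ))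
  have hAz : A z ((ux z : ℂ) + I * (uy z : ℂ)) = a z + g z := by
    simp [ha]
  rw [hAz] at h1
  have e1 : (ofRealCLM (ux z) + (I • ofRealCLM) (-(a z).im) -
      I * (ofRealCLM (uy z) + (I • ofRealCLM) (a z).re)) / 2 + 1 / 2 * conj (g z) =
      conj (((ux z : ℂ) + I * (uy z : ℂ) + (a z + g z)) / 2) := by
    rw [conj_div_two]
    apply Complex.ext <;> simp <;> ring
  rw [e1, h1]
  apply Complex.ext <;> simp <;> ring

theorem mainTheorem7 (Ω : Set ℂ) (hΩ : IsOpen Ω) (hsc : IsSimplyConnected Ω) :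
    (∀ k : ℝ, 0 ≤ k → k < 1 → ∀ (H : ℂ → ℂ → ℂ) (G : ℂ → ℂ), IsLipschitzField Ω k H →
      ∃ (A : ℂ → ℂ → ℂ) (g : ℂ → ℂ),
        IsStronglyElliptic Ω ((1 + k) / (1 - k)) A ∧ MemL2loc Ω g ∧
        ∀ f : ℂ → ℂ, SolvesBeltrami Ω H G f →
          SolvesLerayLions Ω A g (fun z => (f z).re)) ∧
    (∀ K : ℝ, 1 ≤ K → ∀ (A : ℂ → ℂ → ℂ) (g : ℂ → ℂ), IsStronglyElliptic Ω K A → MemL2loc Ω g →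
      ∃ (H : ℂ → ℂ → ℂ) (G : ℂ → ℂ),
        IsLipschitzField Ω ((K - 1) / (K + 1)) H ∧ (∀ z ∈ Ω, H z 0 = 0) ∧ MemL2loc Ω G ∧
        ∀ u : ℂ → ℝ, SolvesLerayLions Ω A g u →
          ∃ v : ℂ → ℝ, MemW12loc Ω v ∧
            SolvesBeltrami Ω H G (fun z => (u z : ℂ) + I * (v z : ℂ))) ∧
    (∀ k K : ℝ, 0 ≤ k → k < 1 → 1 ≤ K →
      (K = (1 + k) / (1 - k) ↔ k = (K - 1) / (K + 1))) := by
  refine ⟨fun k hk0 hk1 H G hH => hH.exists_lerayLions hΩ hk0 hk1 G,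
    fun K hK A g hA hg => hA.exists_beltrami hΩ hsc hK hg, fun k K hk0 hk1 hK => ?_⟩
  have h1 : 1 - k ≠ 0 := by linarith
  have h2 : K + 1 ≠ 0 := by linarith
  rw [eq_div_iff h1, eq_div_iff h2]
  constructor <;> intro h <;> linarith
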